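/- Let $B=\mathbb Q[x_1,x_2,\dots]$, and let $$\Gamma(z)=\exp\Big(\sum_{i\ge1}x_iz^i\Big)\exp\Big(-\sum_{i\ge1}\frac1{iz^i}\frac{\partial}{\partial x_i}\Big),\qquad \Gamma^*(z)=\exp\Big(-\sum_{i\ge1}x_iz^i\Big)\exp\Big(\sum_{i\ge1}\frac1{iz^i}\frac{\partial}{\partial x_i}\Big)$$ be the bosonic vertex operators $B\to B((z))$. Let $\mathrm{Res}_z$ denote the coefficient of $z^{-1}$. Define $e_n\in B$ by $1-e_1z+e_2z^2-\cdots=\exp(-\sum_{i\ge1}x_iz^i)$, so that $B=\mathbb Q[e_1,e_2,\dots]$. For $r\ge0$ let $B_{r}\otimes\mathbb Q=\mathbb Q[e_1,\dots,e_r]\subseteq B$, put $E_r(z)=1-e_1z+\cdots+(-1)^re_rz^r$ and $\sum_{n\ge 0}h_nz^n=1/E_r(z)$, with $h_n=0$ for $n<0$. For a partition $\lambda=(\lambda_1\ge\cdots\ge\lambda_r\ge0)$ put $\Delta_\lambda(H_r)=\det(h_{\lambda_j-j+i})_{1\le i,j\le r}$; these form a $\mathbb Q$-basis of $B_r\otimes\mathbb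 Q$. Let $M$ be the $\mathbb Q$-vector space with basis $b_0,b_1,\dots$, and let $\phi_r:B_r\otimes\mathbb Q\to\bigwedge^rM$ be the linear map with $\phi_r(\Delta_\lambda(H_r))=b_{\lambda_r}\wedge b_{1+\lambda_{r-1}}\wedge\cdots\wedge b_{r-1+\lambda_1}$. Let $\mathcal G_r\otimes\mathbb Q\subseteq\bigwedge^rM$ be the Grassmann cone of all decomposable tensors $m_1\wedge\cdots\wedge m_r$ with $m_1,\dots,m_r\in M$. One says that $\tau\in B$ corresponds to an element of $\mathcal G_\infty\otimes\mathbb Q$ if there is $r\ge0$ such that, for all $s\ge r$, $\tau\in B_s\otimes\mathbb Q$ and $\phi_s(\tau)\in\mathcal G_s\otimes\mathbb Q$. Then a polynomial $\tau\in B$ corresponds to an element of $\mathcal G_\infty\otimes\mathbb Q$ if and only if $$\mathrm{Res}_z\,\Gamma^*(z)\tau\otimes\Gamma(z)\tau=0\quad\text{in } B\otimes_{\mathbb Q}B .$$ -/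

import Mathlib

namespace KP

open scoped ExteriorAlgebra TensorProduct

/-! ### Exponentials of formal power series -/

/-- `exp f = ∑_k f ^ k / k!` for a formal power series `f` without constant term, over a (possibly
non-commutative) `ℚ`-algebra. Since `f ^ k` is divisible by the `k`-th power of the variable, only
the terms with `k ≤ n` contribute to the `n`-th coefficient. -/
noncomputable def formalExp {R : Type*} [Ring R] [Algebra ℚ R] (f : PowerSeries R) :
    PowerSeries R :=
  PowerSeries.mk fun n => ∑ k ∈ Finset.range (n + 1),
    ((k.factorial : ℚ)⁻¹) • PowerSeries.coeff n (f ^ k)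

/-! ### The ring `B = ℚ[x₁, x₂, …]` and the vertex operators -/

/-- `B = ℚ[x₁, x₂, …]`; the variable `x_{i+1}` is `MvPolynomial.X i`. -/
abbrev B : Type := MvPolynomial ℕ ℚ

/-- `∑_{i ≥ 1} x_i z ^ i`. -/
noncomputable def xSeries : PowerSeries B :=
  PowerSeries.mk fun n => if n = 0 then 0 else MvPolynomial.X (n - 1)

/-- `∑_{i ≥ 1} (1 / i) (∂ / ∂x_i) w ^ i`, a power series in `w = z⁻¹` whose coefficients are
endomorphisms of `B`. -/
noncomputable def dSeries : PowerSeries (Module.End ℚ B) :=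
  PowerSeries.mk fun n => if n = 0 then 0 else
    ((n : ℚ)⁻¹) • (MvPolynomial.pderiv (R := ℚ) (n - 1)).toLinearMap

/-- The weight for which `x_i` has weight `i`. -/
def wt : ℕ → ℕ := fun i => i + 1

/-- `φ` lowers the weight by exactly `n`. -/
def Lowers (n : ℕ) (φ : Module.End ℚ B) : Prop :=
  ∀ (m : ℕ) (p : B), MvPolynomial.IsWeightedHomogeneous wt p m →
    (n ≤ m → MvPolynomial.IsWeightedHomogeneous wt (φ p) (m - n)) ∧ (m < n → φ p = 0)

theorem Lowers.zero (n : ℕ) : Lowers n 0 := fun _ _ _ =>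
  ⟨fun _ => MvPolynomial.isWeightedHomogeneous_zero ℚ wt _, fun _ => rfl⟩

theorem Lowers.one : Lowers 0 1 := fun m p hp =>
  ⟨fun _ => by simpa using hp, fun h => absurd h (Nat.not_lt_zero m)⟩

theorem Lowers.add {n : ℕ} {φ ψ : Module.End ℚ B} (hφ : Lowers n φ) (hψ : Lowers n ψ) :
    Lowers n (φ + ψ) := fun m p hp =>
  ⟨fun h => by
    simpa using (MvPolynomial.weightedHomogeneousSubmodule ℚ wt (m - n)).add_mem
      ((hφ m p hp).1 h) ((hψ m p hp).1 h),
   fun h => by simp [(hφ m p hp).2 h, (hψ m p hp).2 h]⟩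

theorem Lowers.smul {n : ℕ} {φ : Module.End ℚ B} (c : ℚ) (hφ : Lowers n φ) :
    Lowers n (c • φ) := fun m p hp =>
  ⟨fun h => by
    simpa using (MvPolynomial.weightedHomogeneousSubmodule ℚ wt (m - n)).smul_mem c
      ((hφ m p hp).1 h),
   fun h => by simp [(hφ m p hp).2 h]⟩

theorem Lowers.sum {ι : Type*} {n : ℕ} (s : Finset ι) (f : ι → Module.End ℚ B)
    (h : ∀ i ∈ s, Lowers n (f i)) : Lowers n (∑ i ∈ s, f i) :=
  Finset.sum_induction f (Lowers n) (fun _ _ => Lowers.add) (Lowers.zero n) h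

theorem Lowers.mul {n k : ℕ} {φ ψ : Module.End ℚ B} (hφ : Lowers n φ) (hψ : Lowers k ψ) :
    Lowers (n + k) (φ * ψ) := by
  intro m p hp
  rcases lt_or_ge m k with hk | hk
  · refine ⟨fun h => by omega, fun _ => ?_⟩
    simp [(hψ m p hp).2 hk]
  · have h1 := (hψ m p hp).1 hk
    refine ⟨fun h => ?_, fun h => ?_⟩
    · have := (hφ _ _ h1).1 (by omega)
      rwa [show m - k - n = m - (n + k) by omega] at this
    · exact (hφ _ _ h1).2 (by omega)

theorem Lowers.pderiv (i : ℕ) :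
    Lowers (i + 1) (MvPolynomial.pderiv (R := ℚ) i).toLinearMap := by
  intro m p hp
  have key : ∀ s ∈ p.support,
      (i + 1 ≤ m → MvPolynomial.IsWeightedHomogeneous wt
        (MvPolynomial.pderiv i (MvPolynomial.monomial s (p.coeff s))) (m - (i + 1))) ∧
      (m < i + 1 → MvPolynomial.pderiv i (MvPolynomial.monomial s (p.coeff s)) = 0) := by
    intro s hs
    have hw : Finsupp.weight wt s = m := hp (by simpa using hs)
    rw [MvPolynomial.pderiv_monomial]
    by_cases hsi : s i = 0
    · simp [hsi, MvPolynomial.isWeightedHomogeneous_zero]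
    · have hle : Finsupp.single i 1 ≤ s := by
        simpa [Finsupp.single_le_iff] using Nat.one_le_iff_ne_zero.2 hsi
      have h2 : Finsupp.weight wt (s - Finsupp.single i 1) + (i + 1) = m := by
        rw [← hw]
        conv_rhs => rw [← tsub_add_cancel_of_le hle]
        rw [map_add]
        simp [Finsupp.weight_apply, wt]
      refine ⟨fun _ => MvPolynomial.isWeightedHomogeneous_monomial _ _ _ (by omega),
        fun h => by omega⟩
  have hsum : (MvPolynomial.pderiv (R := ℚ) i) p =
      ∑ s ∈ p.support, MvPolynomial.pderiv i (MvPolynomial.monomial s (p.coeff s)) := by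
    conv_lhs => rw [p.as_sum]
    rw [map_sum]
  constructor
  · intro h
    change MvPolynomial.IsWeightedHomogeneous wt ((MvPolynomial.pderiv (R := ℚ) i) p) _
    rw [hsum]
    exact (MvPolynomial.weightedHomogeneousSubmodule ℚ wt (m - (i + 1))).sum_mem
      fun s hs => (key s hs).1 h
  · intro h
    change (MvPolynomial.pderiv (R := ℚ) i) p = 0
    rw [hsum]
    exact Finset.sum_eq_zero fun s hs => (key s hs).2 h

theorem lowers_pow {f : PowerSeries (Module.End ℚ B)}
    (hf : ∀ n, Lowers n (PowerSeries.coeff n f)) (k : ℕ) :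
    ∀ n, Lowers n (PowerSeries.coeff n (f ^ k)) := by
  induction k with
  | zero =>
    intro n
    rw [pow_zero, PowerSeries.coeff_one]
    split_ifs with h
    · subst h; exact Lowers.one
    · exact Lowers.zero n
  | succ k ih =>
    intro n
    rw [pow_succ, PowerSeries.coeff_mul]
    refine Lowers.sum _ _ fun p hp => ?_
    rw [← Finset.HasAntidiagonal.mem_antidiagonal.1 hp]
    exact (ih _).mul (hf _)

theorem lowers_dSeries (n : ℕ) : Lowers n (PowerSeries.coeff n dSeries) := by
  rw [dSeries, PowerSeries.coeff_mk]
  split_ifs with h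
  · exact Lowers.zero n
  · have := (Lowers.pderiv (n - 1)).smul ((n : ℚ)⁻¹)
    rwa [Nat.sub_add_cancel (Nat.one_le_iff_ne_zero.2 h)] at this

theorem lowers_exp (c : ℚ) (n : ℕ) :
    Lowers n (PowerSeries.coeff n (formalExp (c • dSeries))) := by
  rw [formalExp, PowerSeries.coeff_mk]
  refine Lowers.sum _ _ fun k _ => Lowers.smul _ (lowers_pow (fun m => ?_) k n)
  exact (lowers_dSeries m).smul c

theorem exp_dSeries_eventually_zero (c : ℚ) (τ : B) (n : ℕ)
    (hn : MvPolynomial.weightedTotalDegree wt τ < n) :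
    PowerSeries.coeff n (formalExp (c • dSeries)) τ = 0 := by
  conv_lhs => rw [τ.as_sum]
  rw [map_sum]
  refine Finset.sum_eq_zero fun s hs => ?_
  exact (lowers_exp c n _ _ (MvPolynomial.isWeightedHomogeneous_monomial wt s _ rfl)).2
    ((MvPolynomial.le_weightedTotalDegree wt hs).trans_lt hn)

/-- `exp (c ∑_{i ≥ 1} (1 / (i z ^ i)) ∂ / ∂x_i) τ`, as a Laurent series in `z` (in fact a polynomial
in `z⁻¹`): the coefficient of `z ^ (-n)` is the `n`-th coefficient of the exponential in
`w = z⁻¹`, applied to `τ`. -/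
noncomputable def expD (c : ℚ) (τ : B) : LaurentSeries B :=
  HahnSeries.ofSuppBddBelow
    (fun k : ℤ => if k ≤ 0 then PowerSeries.coeff (-k).toNat (formalExp (c • dSeries)) τ else 0)
    ⟨-((MvPolynomial.weightedTotalDegree wt τ : ℕ) : ℤ), by
      intro k hk
      by_contra hlt
      apply hk
      have : k ≤ 0 := by omega
      simp only [this, if_true]
      exact exp_dSeries_eventually_zero c τ _ (by omega)⟩

/-- The vertex operator
`Γ(z) = exp (∑_{i ≥ 1} x_i z ^ i) exp (- ∑_{i ≥ 1} (1 / (i z ^ i)) ∂ / ∂x_i) : B → B((z))`. -/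
noncomputable def Gam (τ : B) : LaurentSeries B :=
  HahnSeries.ofPowerSeries ℤ B (formalExp xSeries) * expD (-1) τ

/-- The vertex operator
`Γ*(z) = exp (- ∑_{i ≥ 1} x_i z ^ i) exp (∑_{i ≥ 1} (1 / (i z ^ i)) ∂ / ∂x_i) : B → B((z))`. -/
noncomputable def GamStar (τ : B) : LaurentSeries B :=
  HahnSeries.ofPowerSeries ℤ B (formalExp (-xSeries)) * expD 1 τ

/-- For `f, g ∈ B((z))`, the series `f ⊗ g ∈ (B ⊗ B)((z))`. -/
noncomputable def laurentTensor (f g : LaurentSeries B) : LaurentSeries (B ⊗[ℚ] B) :=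
  f.map (Algebra.TensorProduct.includeLeft : B →ₐ[ℚ] B ⊗[ℚ] B) *
    g.map (Algebra.TensorProduct.includeRight : B →ₐ[ℚ] B ⊗[ℚ] B)

/-- `Res_z`: the coefficient of `z⁻¹`. -/
noncomputable def residue {R : Type*} [Zero R] (f : LaurentSeries R) : R := f.coeff (-1)

/-- The Hirota bilinear form of the KP hierarchy: `Res_z Γ*(z)τ ⊗ Γ(z)τ = 0` in `B ⊗ B`. -/
def HirotaKP (τ : B) : Prop := residue (laurentTensor (GamStar τ) (Gam τ)) = 0

/-! ### The rings `B_r ⊗ ℚ = ℚ[e₁, …, e_r]` and Schur determinants -/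

/-- `B_r ⊗ ℚ = ℚ[e₁, …, e_r]`; the variable `e_{i+1}` is `MvPolynomial.X i`. -/
abbrev Br (r : ℕ) : Type := MvPolynomial (Fin r) ℚ

/-- `E_r(z) = 1 - e₁ z + ⋯ + (-1) ^ r e_r z ^ r`. -/
noncomputable def E (r : ℕ) : PowerSeries (Br r) :=
  1 + ∑ i : Fin r, PowerSeries.C ((-1) ^ ((i : ℕ) + 1) * MvPolynomial.X i) *
    PowerSeries.X ^ ((i : ℕ) + 1)

/-- `1 / E_r(z)`. -/
noncomputable def H (r : ℕ) : PowerSeries (Br r) := PowerSeries.invOfUnit (E r) 1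

/-- `h_n ∈ B_r`: the coefficient of `z ^ n` in `1 / E_r(z)`, and `0` for `n < 0`. -/
noncomputable def h (r : ℕ) (n : ℤ) : Br r :=
  if 0 ≤ n then PowerSeries.coeff n.toNat (H r) else 0

/-- The partitions of length at most `r`, written as `λ₁ ≥ ⋯ ≥ λ_r ≥ 0`. -/
abbrev Par (r : ℕ) : Type := {l : Fin r → ℕ // Antitone l}

/-- The Schur determinant `Δ_λ(H_r) = det (h_{λ_j - j + i})_{1 ≤ i, j ≤ r}`. -/
noncomputable def schurDet {r : ℕ} (l : Par r) : Br r :=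
  Matrix.det (Matrix.of fun i j : Fin r => h r ((l.1 j : ℤ) - (j : ℤ) + (i : ℤ)))

/-! ### The Schur determinants form a basis of `B_r ⊗ ℚ` -/

/-- The exponents `k + λ_{r-k}`, for `0 ≤ k < r`. -/
def expo {r : ℕ} (l : Par r) (k : Fin r) : ℕ := (k : ℕ) + l.1 (Fin.rev k)

theorem expo_strictMono {r : ℕ} (l : Par r) : StrictMono (expo l) := by
  intro a b hab
  have h1 := l.2 (Fin.rev_le_rev.2 hab.le)
  have h2 : (a : ℕ) < b := hab
  simp only [expo]
  omega

theorem expo_injective {r : ℕ} {l m : Par r} (hlm : expo l = expo m) : l = m := by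
  apply Subtype.ext
  funext i
  have := congrFun hlm (Fin.rev i)
  simpa [expo] using this

theorem exists_expo {r : ℕ} (n : Fin r → ℕ) (hn : StrictMono n) : ∃ l : Par r, expo l = n := by
  have hmono : ∀ a b : Fin r, a ≤ b → n a + ((b : ℕ) - a) ≤ n b := by
    intro a b hab
    obtain ⟨d, hd⟩ := Nat.exists_eq_add_of_le (show (a : ℕ) ≤ b from hab)
    induction d generalizing b with
    | zero =>
      have : a = b := Fin.ext (by omega)
      subst this; simp
    | succ d ih =>
      have hb := b.2
      let c : Fin r := ⟨a + d, by omega⟩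
      have h1 := ih c (Fin.le_def.2 (by simp [c])) rfl
      have h2 : n c < n b := hn (Fin.lt_def.2 (by simp only [c]; omega))
      simp only [c] at h1 h2
      omega
  have hge : ∀ a : Fin r, (a : ℕ) ≤ n a := by
    intro a
    have ha := a.2
    have := hmono ⟨0, by omega⟩ a (Fin.le_def.2 (Nat.zero_le _))
    simp only at this
    omega
  refine ⟨⟨fun i => n (Fin.rev i) - (Fin.rev i : ℕ), ?_⟩, ?_⟩
  · intro i j hij
    have h1 := hmono _ _ (Fin.rev_le_rev.2 hij)
    have h2 : (Fin.rev j : ℕ) ≤ Fin.rev i := Fin.rev_le_rev.2 hij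
    have h3 := hge (Fin.rev j)
    simp only
    omega
  · funext k
    have := hge k
    simp only [expo, Fin.rev_rev]
    omega

/-- `det (h_{n_a - b})`, for an arbitrary sequence `n`. -/
noncomputable def hDet {r : ℕ} (n : Fin r → ℕ) : Br r :=
  Matrix.det (Matrix.of fun a b : Fin r => h r ((n a : ℤ) - (b : ℤ)))

theorem schurDet_eq_hDet {r : ℕ} (l : Par r) : schurDet l = hDet (expo l) := by
  rw [schurDet, hDet, ← Matrix.det_transpose, ← Matrix.det_submatrix_equiv_self Fin.revPerm]
  congr 1
  ext1 a b
  simp only [Matrix.submatrix_apply, Matrix.transpose_apply, Matrix.of_apply, Fin.revPerm_apply,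
    expo, Fin.val_rev]
  congr 1
  have := a.2
  have := b.2
  push_cast
  omega

/-- `ℚ[e₁, …, e_r] → ℚ[x₁, …, x_r]`, sending `e_i` to the elementary symmetric polynomial. -/
noncomputable def toSymm (r : ℕ) : Br r →ₐ[ℚ] Br r :=
  MvPolynomial.aeval fun i : Fin r => MvPolynomial.esymm (Fin r) ℚ ((i : ℕ) + 1)

theorem toSymm_injective (r : ℕ) : Function.Injective (toSymm r) := by
  intro p q hpq
  have h1 := MvPolynomial.esymmAlgHom_fin_injective (R := ℚ) (n := r) (m := r) le_rfl
  apply h1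
  apply Subtype.ext
  rw [MvPolynomial.esymmAlgHom_apply, MvPolynomial.esymmAlgHom_apply]
  exact hpq

theorem prod_one_add_eq {r : ℕ} :
    PowerSeries.map (toSymm r : Br r →+* Br r) (E r) =
      ∏ i : Fin r, (1 - PowerSeries.C (MvPolynomial.X i : Br r) * PowerSeries.X) := by
  simp_rw [sub_eq_add_neg]
  rw [Finset.prod_one_add, Finset.sum_powerset]
  rw [Finset.card_univ, Fintype.card_fin, Finset.sum_range_succ']
  rw [add_comm]
  simp only [E, map_add, map_one, map_sum, map_mul, map_pow, PowerSeries.map_C, PowerSeries.map_X,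
    map_neg]
  congr 1
  · simp
  · rw [← Fin.sum_univ_eq_sum_range
      (fun k => ∑ t ∈ Finset.powersetCard (k + 1) (Finset.univ : Finset (Fin r)),
        ∏ i ∈ t, -(PowerSeries.C (MvPolynomial.X i : Br r) * PowerSeries.X))]
    refine Finset.sum_congr rfl fun i _ => ?_
    have : (toSymm r : Br r →+* Br r) (MvPolynomial.X i) =
        ∑ t ∈ Finset.powersetCard ((i : ℕ) + 1) (Finset.univ : Finset (Fin r)),
          ∏ j ∈ t, MvPolynomial.X j := by
      simp [toSymm, MvPolynomial.esymm]
    rw [this, map_sum, Finset.mul_sum, Finset.sum_mul]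
    refine Finset.sum_congr rfl fun t ht => ?_
    rw [Finset.prod_neg, Finset.prod_mul_distrib, Finset.prod_const,
      (Finset.mem_powersetCard.1 ht).2, map_prod]
    ring

theorem E_mul_H (r : ℕ) : E r * H r = 1 := by
  apply PowerSeries.mul_invOfUnit
  simp [E]

/-- The `b`-th coefficient of `∏_{i ≠ j} (1 - x_i z)`. -/
noncomputable def cofac (r : ℕ) (b j : Fin r) : Br r :=
  PowerSeries.coeff (b : ℕ) (∏ i ∈ Finset.univ.erase j,
    (1 - PowerSeries.C (MvPolynomial.X i : Br r) * PowerSeries.X))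

theorem coeff_cofac_eq_zero {r : ℕ} (j : Fin r) (b : ℕ) (hb : r ≤ b) :
    PowerSeries.coeff b (∏ i ∈ Finset.univ.erase j,
      (1 - PowerSeries.C (MvPolynomial.X i : Br r) * PowerSeries.X)) = 0 := by
  have h1 : (∏ i ∈ Finset.univ.erase j,
      (1 - PowerSeries.C (MvPolynomial.X i : Br r) * PowerSeries.X)) =
      ((∏ i ∈ Finset.univ.erase j,
      (1 - Polynomial.C (MvPolynomial.X i : Br r) * Polynomial.X) : Polynomial (Br r)) :
        PowerSeries (Br r)) := by
    rw [← Polynomial.coeToPowerSeries.ringHom_apply, map_prod]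
    refine Finset.prod_congr rfl fun i _ => ?_
    simp [Polynomial.coeToPowerSeries.ringHom_apply]
  rw [h1, Polynomial.coeff_coe]
  apply Polynomial.coeff_eq_zero_of_natDegree_lt
  refine (Polynomial.natDegree_prod_le _ _).trans_lt ?_
  refine (Finset.sum_le_card_nsmul _ _ 1 fun i _ => ?_).trans_lt ?_
  · refine (Polynomial.natDegree_sub_le _ _).trans ?_
    simp
  · have := j.2
    simp
    omega

theorem pow_eq_sum {r : ℕ} (n : ℕ) (j : Fin r) :
    (MvPolynomial.X j : Br r) ^ n =
      ∑ b : Fin r, toSymm r (h r ((n : ℤ) - (b : ℤ))) * cofac r b j := by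
  set Q := ∏ i ∈ Finset.univ.erase j,
    (1 - PowerSeries.C (MvPolynomial.X i : Br r) * PowerSeries.X) with hQ
  set T := PowerSeries.map (toSymm r : Br r →+* Br r) (H r) with hT
  set L := 1 - PowerSeries.C (MvPolynomial.X j : Br r) * PowerSeries.X with hL
  have h1 : (L * Q) * T = 1 := by
    rw [hL, hQ, Finset.mul_prod_erase Finset.univ
      (fun i => 1 - PowerSeries.C (MvPolynomial.X i : Br r) * PowerSeries.X) (Finset.mem_univ j),
      ← prod_one_add_eq, hT, ← map_mul, E_mul_H, map_one]
  have h2 : PowerSeries.mk (fun n => (MvPolynomial.X j : Br r) ^ n) * L = 1 := by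
    ext1 m
    rw [hL, mul_sub, mul_one, map_sub, ← mul_assoc, PowerSeries.coeff_mk]
    cases m with
    | zero => simp
    | succ m =>
      rw [PowerSeries.coeff_succ_mul_X, PowerSeries.coeff_mul_C, PowerSeries.coeff_mk,
        PowerSeries.coeff_one]
      simp [pow_succ]
  have h3 : PowerSeries.mk (fun n => (MvPolynomial.X j : Br r) ^ n) = Q * T := by
    calc _ = PowerSeries.mk (fun n => (MvPolynomial.X j : Br r) ^ n) * ((L * Q) * T) := by
          rw [h1, mul_one]
      _ = (PowerSeries.mk (fun n => (MvPolynomial.X j : Br r) ^ n) * L) * (Q * T) := by ring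
      _ = _ := by rw [h2, one_mul]
  have h4 := congrArg (PowerSeries.coeff n) h3
  rw [PowerSeries.coeff_mk, PowerSeries.coeff_mul] at h4
  rw [h4, Finset.Nat.sum_antidiagonal_eq_sum_range_succ_mk]
  change _ = ∑ b : Fin r, toSymm r (h r ((n : ℤ) - ((b : ℕ) : ℤ))) * PowerSeries.coeff (b : ℕ) Q
  rw [Fin.sum_univ_eq_sum_range (fun b => toSymm r (h r ((n : ℤ) - (b : ℤ))) *
    PowerSeries.coeff b Q)]
  have hterm : ∀ b, b ≤ n → toSymm r (h r ((n : ℤ) - (b : ℤ))) =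
      PowerSeries.coeff (n - b) T := by
    intro b hb
    rw [h, if_pos (by omega), hT, PowerSeries.coeff_map]
    rw [show ((n : ℤ) - (b : ℤ)).toNat = n - b by omega]
    rfl
  have hA : ∑ k ∈ Finset.range n.succ, PowerSeries.coeff k Q * PowerSeries.coeff (n - k) T =
      ∑ k ∈ Finset.range (max n.succ r), toSymm r (h r ((n : ℤ) - (k : ℤ))) *
        PowerSeries.coeff k Q := by
    rw [← Finset.sum_subset (Finset.range_subset_range.2 (le_max_left n.succ r))]
    · refine Finset.sum_congr rfl fun k hk => ?_
      rw [hterm k (by simpa [Nat.lt_succ_iff] using hk), mul_comm]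
    · intro k _ hk
      rw [h, if_neg, map_zero, zero_mul]
      simp at hk
      omega
  rw [hA]
  symm
  apply Finset.sum_subset (Finset.range_subset_range.2 (le_max_right n.succ r))
  intro k _ hk
  rw [hQ, coeff_cofac_eq_zero j k (by simpa using hk), mul_zero]

/-- The alternant `det (x_j ^ {n_a})`. -/
noncomputable def alt {r : ℕ} (n : Fin r → ℕ) : Br r :=
  Matrix.det (Matrix.of fun a j : Fin r => (MvPolynomial.X j : Br r) ^ n a)

theorem toSymm_hDet {r : ℕ} (n : Fin r → ℕ) :
    toSymm r (hDet n) * (Matrix.of (cofac r)).det = alt n := by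
  rw [hDet, AlgHom.map_det, ← Matrix.det_mul, alt]
  congr 1
  ext1 a j
  simp only [Matrix.mul_apply, Matrix.of_apply, AlgHom.mapMatrix_apply, Matrix.map_apply]
  exact (pow_eq_sum (n a) j).symm

theorem det_cofac_ne_zero (r : ℕ) : (Matrix.of (cofac r)).det ≠ 0 := by
  intro h0
  have h1 := toSymm_hDet (r := r) (fun a => (a : ℕ))
  rw [h0, mul_zero] at h1
  have h2 : alt (r := r) (fun a => (a : ℕ)) =
      (Matrix.vandermonde (fun i : Fin r => (MvPolynomial.X i : Br r))).det := by
    rw [alt, ← Matrix.det_transpose]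
    rfl
  rw [h2] at h1
  exact Matrix.det_vandermonde_ne_zero_iff.2 (MvPolynomial.X_injective) h1.symm

theorem alt_apply {r : ℕ} (n : Fin r → ℕ) :
    alt n = ∑ σ : Equiv.Perm (Fin r), (Equiv.Perm.sign σ : ℤ) •
      ∏ a, (MvPolynomial.X (σ a) : Br r) ^ n a := by
  rw [alt, ← Matrix.det_transpose, Matrix.det_apply]
  rfl

theorem esymm_mul_alt {r : ℕ} (k : ℕ) (n : Fin r → ℕ) :
    MvPolynomial.esymm (Fin r) ℚ k * alt n =
      ∑ t ∈ Finset.powersetCard k (Finset.univ : Finset (Fin r)),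
        alt (fun a => n a + if a ∈ t then 1 else 0) := by
  simp_rw [alt_apply]
  rw [Finset.sum_comm, Finset.mul_sum]
  refine Finset.sum_congr rfl fun σ _ => ?_
  have hσ : MvPolynomial.esymm (Fin r) ℚ k =
      ∑ t ∈ Finset.powersetCard k (Finset.univ : Finset (Fin r)),
        ∏ a ∈ t, MvPolynomial.X (σ a) := by
    rw [← MvPolynomial.rename_esymm (Fin r) ℚ k σ, MvPolynomial.esymm, map_sum]
    simp [map_prod]
  rw [hσ, Finset.sum_mul]
  refine Finset.sum_congr rfl fun t _ => ?_
  rw [mul_smul_comm]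
  congr 1
  simp_rw [pow_add]
  rw [Finset.prod_mul_distrib, mul_comm]
  congr 1
  simp [pow_ite, Finset.prod_ite_mem]

theorem X_mul_hDet {r : ℕ} (i : Fin r) (n : Fin r → ℕ) :
    MvPolynomial.X i * hDet n =
      ∑ t ∈ Finset.powersetCard ((i : ℕ) + 1) (Finset.univ : Finset (Fin r)),
        hDet (fun a => n a + if a ∈ t then 1 else 0) := by
  apply toSymm_injective r
  apply mul_right_cancel₀ (det_cofac_ne_zero r)
  rw [map_mul, mul_assoc, toSymm_hDet, map_sum, Finset.sum_mul]
  simp_rw [toSymm_hDet]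
  rw [← esymm_mul_alt]
  simp [toSymm]

theorem hDet_mem_span {r : ℕ} (n : Fin r → ℕ) :
    hDet n ∈ Submodule.span ℚ (Set.range (schurDet (r := r))) := by
  by_cases hn : Function.Injective n
  · have hs : StrictMono (n ∘ Tuple.sort n) :=
      (Tuple.monotone_sort n).strictMono_of_injective (hn.comp (Tuple.sort n).injective)
    obtain ⟨l, hl⟩ := exists_expo _ hs
    have h1 : schurDet l = (Equiv.Perm.sign (Tuple.sort n) : Br r) * hDet n := by
      rw [schurDet_eq_hDet, hl, hDet, hDet, ← Matrix.det_permute]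
      rfl
    have h2 : hDet n = (Equiv.Perm.sign (Tuple.sort n) : ℤ) • schurDet l := by
      rw [h1, zsmul_eq_mul, ← mul_assoc, ← Int.cast_mul, ← Units.val_mul]
      simp
    rw [h2]
    exact Submodule.smul_of_tower_mem _ _ (Submodule.subset_span ⟨l, rfl⟩)
  · have : hDet n = 0 := by
      simp only [Function.Injective, not_forall] at hn
      obtain ⟨a, b, hab, hne⟩ := hn
      refine Matrix.det_zero_of_row_eq hne ?_
      funext c
      simp [hab]
    rw [this]
    exact Submodule.zero_mem _

theorem hDet_id (r : ℕ) : hDet (r := r) (fun a => (a : ℕ)) = 1 := by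
  rw [hDet, Matrix.det_of_isLowerTriangular]
  · apply Finset.prod_eq_one
    intro a _
    simp [h, H, PowerSeries.coeff_zero_eq_constantCoeff]
  · intro a b hab
    have : (a : ℕ) < b := hab
    simp only [Matrix.of_apply, h]
    rw [if_neg (by omega)]

theorem schurDet_span (r : ℕ) :
    ⊤ ≤ Submodule.span ℚ (Set.range (schurDet (r := r))) := by
  set S := Submodule.span ℚ (Set.range (schurDet (r := r))) with hS
  intro p _
  induction p using MvPolynomial.induction_on with
  | C a =>
    have h1 : (1 : Br r) ∈ S := hDet_id r ▸ hDet_mem_span _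
    have := S.smul_mem a h1
    rwa [MvPolynomial.smul_eq_C_mul, mul_one] at this
  | add p q hp hq => exact S.add_mem (hp trivial) (hq trivial)
  | mul_X p i hp =>
    have hp' := hp trivial
    clear hp
    rw [hS] at hp'
    induction hp' using Submodule.span_induction with
    | mem x hx =>
      obtain ⟨l, rfl⟩ := hx
      rw [schurDet_eq_hDet, mul_comm, X_mul_hDet]
      exact S.sum_mem fun t _ => hDet_mem_span _
    | zero => rw [zero_mul]; exact S.zero_mem
    | add x y _ _ hx hy => rw [add_mul]; exact S.add_mem (hx trivial) (hy trivial)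
    | smul c x _ hx => rw [smul_mul_assoc]; exact S.smul_mem c (hx trivial)

theorem coeff_alt {r : ℕ} (l m : Par r) :
    MvPolynomial.coeff (Finsupp.equivFunOnFinite.symm (expo l)) (alt (expo m)) =
      if m = l then 1 else 0 := by
  have hmon : ∀ σ : Equiv.Perm (Fin r), ∏ a, (MvPolynomial.X (σ a) : Br r) ^ expo m a =
      MvPolynomial.monomial (Finsupp.equivFunOnFinite.symm (expo m ∘ σ.symm)) 1 := by
    intro σ
    rw [MvPolynomial.monomial_eq, map_one, one_mul, Finsupp.prod_fintype _ _ (by simp)]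
    rw [← Equiv.prod_comp σ (fun x => (MvPolynomial.X x : Br r) ^
      (Finsupp.equivFunOnFinite.symm (expo m ∘ σ.symm)) x)]
    simp
  have hσ : ∀ σ : Equiv.Perm (Fin r), expo m ∘ σ.symm = expo l → σ = 1 ∧ m = l := by
    intro σ hσ
    have hrange : Set.range (expo m) = Set.range (expo l) := by
      rw [← hσ, Set.range_comp, σ.symm.surjective.range_eq, Set.image_univ]
    have heq : expo m = expo l :=
      (expo_strictMono m).range_inj (expo_strictMono l) |>.1 hrange
    refine ⟨?_, expo_injective heq⟩
    ext a
    have h1 := congrFun hσ (σ a)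
    rw [← heq] at h1
    simp only [Function.comp_apply, Equiv.symm_apply_apply] at h1
    simpa using congrArg Fin.val ((expo_strictMono m).injective h1).symm
  rw [alt_apply, MvPolynomial.coeff_sum]
  simp_rw [hmon, MvPolynomial.coeff_smul, MvPolynomial.coeff_monomial]
  split_ifs with hml
  · subst hml
    rw [Finset.sum_eq_single 1]
    · rw [if_pos (by rfl)]
      simp
    · intro σ _ hne
      rw [if_neg, smul_zero]
      intro he
      exact hne (hσ σ (Finsupp.equivFunOnFinite.symm.injective he)).1
    · simp
  · refine Finset.sum_eq_zero fun σ _ => ?_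
    rw [if_neg, smul_zero]
    intro he
    exact hml (hσ σ (Finsupp.equivFunOnFinite.symm.injective he)).2

theorem schurDet_linearIndependent (r : ℕ) : LinearIndependent ℚ (schurDet (r := r)) := by
  have halt : LinearIndependent ℚ (fun l : Par r => alt (expo l)) := by
    rw [linearIndependent_iff']
    intro s g hg l hl
    have := congrArg (MvPolynomial.coeff (Finsupp.equivFunOnFinite.symm (expo l))) hg
    simpa [MvPolynomial.coeff_sum, coeff_alt, hl] using this
  let f : Br r →ₗ[ℚ] Br r :=
    (LinearMap.mulRight ℚ (Matrix.of (cofac r)).det).comp (toSymm r).toLinearMap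
  have hf : (f ∘ schurDet (r := r)) = fun l : Par r => alt (expo l) := by
    funext l
    simp only [f, Function.comp_apply, LinearMap.comp_apply, LinearMap.mulRight_apply,
      AlgHom.toLinearMap_apply]
    rw [schurDet_eq_hDet, toSymm_hDet]
  exact LinearIndependent.of_comp f (hf ▸ halt)

/-- The basis `(Δ_λ(H_r))`, `λ` of length at most `r`, of `B_r ⊗ ℚ`. -/
noncomputable def schurBasis (r : ℕ) : Module.Basis (Par r) ℚ (Br r) :=
  Module.Basis.mk (schurDet_linearIndependent r) (schurDet_span r)

/-! ### Exterior powers and Grassmann cones -/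

/-- `M₀ ⊗ ℚ`, the rational vector space with basis `b₀, b₁, …`. -/
abbrev M : Type := ℕ →₀ ℚ

/-- The basis vector `b_i`. -/
noncomputable def b (i : ℕ) : M := Finsupp.single i 1

/-- `[b]^r_λ = b_{λ_r} ∧ b_{1 + λ_{r-1}} ∧ ⋯ ∧ b_{r-1+λ_1}`. -/
noncomputable def wedge {r : ℕ} (l : Par r) : ⋀[ℚ]^r M :=
  exteriorPower.ιMulti ℚ r fun k : Fin r => b ((k : ℕ) + l.1 (Fin.rev k))

/-- The linear map `φ_r : B_r ⊗ ℚ → ⋀^r (M₀ ⊗ ℚ)` with `φ_r (Δ_λ(H_r)) = [b]^r_λ`. -/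
noncomputable def phi (r : ℕ) : Br r →ₗ[ℚ] ⋀[ℚ]^r M :=
  (schurBasis r).constr ℚ wedge

theorem phi_schurDet {r : ℕ} (l : Par r) : phi r (schurDet l) = wedge l := by
  have := (schurBasis r).constr_basis ℚ wedge l
  rwa [schurBasis, Module.Basis.mk_apply] at this

/-- The Grassmann cone `𝒢_r ⊗ ℚ` of decomposable tensors `m₁ ∧ ⋯ ∧ m_r` in `⋀^r (M₀ ⊗ ℚ)`. -/
def cone (r : ℕ) : Set (⋀[ℚ]^r M) :=
  Set.range (exteriorPower.ιMulti ℚ r : (Fin r → M) → ⋀[ℚ]^r M)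

/-! ### Polynomials corresponding to elements of the cone `𝒢_∞ ⊗ ℚ` -/

/-- `e_n ∈ B`, defined by `1 - e₁ z + e₂ z ^ 2 - ⋯ = exp (- ∑_{i ≥ 1} x_i z ^ i)`. -/
noncomputable def eInf (n : ℕ) : B :=
  (-1) ^ n * PowerSeries.coeff n (formalExp (-xSeries))

/-- The inclusion `B_r ⊗ ℚ = ℚ[e₁, …, e_r] ⊆ ℚ[e₁, e₂, …] = B`. -/
noncomputable def incl (r : ℕ) : Br r →ₐ[ℚ] B :=
  MvPolynomial.aeval fun i : Fin r => eInf ((i : ℕ) + 1)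

/-- `τ` corresponds to an element of `𝒢_∞ ⊗ ℚ`: there is `r` such that for all `s ≥ r` one has
`τ ∈ B_s ⊗ ℚ` and `φ_s (τ) ∈ 𝒢_s ⊗ ℚ`. -/
def CorrespondsToCone (τ : B) : Prop :=
  ∃ r : ℕ, ∀ s ≥ r, ∃ p : Br s, incl s p = τ ∧ phi s p ∈ cone s

end KP

/-!
Specialize `x_i` to `(∑_j y_jⁱ) / i` for finitely many points `y`. The vertex operators then remove
a point from `y`, or add one to it, up to an explicit rational factor in `z`. So the residue,
evaluated at points `z` in the first and `w` in the second tensor factor, is a residue at infinity,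
which Lagrange interpolation turns into a sum over the points of `w`. Up to the
Vandermonde determinants of `z` and `w`, it is the left-hand side of the Plücker relation for the
alternating function `A` of `s` points that is the product of `τ` and the Vandermonde determinant.

If `A` satisfies these relations and `A(y₀) ≠ 0`, then `A` is determined by its values at the
families that differ from `y₀` in at most one point, hence agrees with `A(y₀) det (f_i(y_j))`, where
`f_i(t)` is `A(y₀)⁻¹` times the value of `A` at `y₀` with its `i`-th point replaced by `t`.
Conversely every determinant `det (f_i(y_j))` satisfies them. If `b_n` corresponds to the monomial
`tⁿ`, the Jacobi–Trudi identity says that `φ_s(τ)` corresponds to the function `A`, so `φ_s(τ)` is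
decomposable if and only if `A` satisfies the Plücker relations. An element of `B ⊗ B` vanishes if
its specializations at sufficiently many points do; this recovers the residue equation from the
Plücker relations for large `s`.
-/

namespace KP

open scoped ExteriorAlgebra TensorProduct

/-! ### The formal exponential -/

theorem coeff_pow_eq_zero {R : Type*} [Ring R] {f : PowerSeries R}
    (hf : PowerSeries.constantCoeff f = 0) {n k : ℕ} (hnk : n < k) :
    PowerSeries.coeff n (f ^ k) = 0 :=
  PowerSeries.coeff_of_lt_order n ((Nat.cast_lt.2 hnk).trans_le
    (PowerSeries.le_order_pow_of_constantCoeff_eq_zero k hf))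

theorem pow_succ_mul_of_commutator {A : Type*} [Ring A] {f g c : A} (h : f * g = g * f + c)
    (hc : Commute f c) (k : ℕ) :
    f ^ (k + 1) * g = g * f ^ (k + 1) + (k + 1) • (c * f ^ k) := by
  induction k with
  | zero => simpa using h
  | succ k ih =>
    calc f ^ (k + 2) * g = f * (f ^ (k + 1) * g) := by rw [pow_succ', mul_assoc]
      _ = (f * g) * f ^ (k + 1) + (k + 1) • (f * c * f ^ k) := by
        rw [ih, mul_add, mul_smul_comm, mul_assoc, mul_assoc]
      _ = g * f ^ (k + 2) + (k + 2) • (c * f ^ (k + 1)) := by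
        rw [h, hc.eq, add_mul, mul_assoc c, mul_assoc g, ← pow_succ', ← pow_succ', add_assoc,
          succ_nsmul' _ (k + 1)]

section FormalExp

variable {R : Type*} [Ring R] [Algebra ℚ R]

theorem coeff_formalExp {f : PowerSeries R} (hf : PowerSeries.constantCoeff f = 0) {n N : ℕ}
    (hn : n < N) :
    PowerSeries.coeff n (formalExp f) =
      ∑ k ∈ Finset.range N, (k.factorial : ℚ)⁻¹ • PowerSeries.coeff n (f ^ k) := by
  rw [formalExp, PowerSeries.coeff_mk]
  refine Finset.sum_subset (Finset.range_subset_range.2 hn) fun k _ hk => ?_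
  rw [coeff_pow_eq_zero hf (by simpa using hk), smul_zero]

theorem constantCoeff_formalExp (f : PowerSeries R) :
    PowerSeries.constantCoeff (formalExp f) = 1 := by
  rw [← PowerSeries.coeff_zero_eq_constantCoeff_apply]
  simp [formalExp]

theorem map_formalExp {S : Type*} [Ring S] [Algebra ℚ S] (φ : R →+* S) (f : PowerSeries R) :
    PowerSeries.map φ (formalExp f) = formalExp (PowerSeries.map φ f) := by
  ext n
  simp only [formalExp, PowerSeries.coeff_map, PowerSeries.coeff_mk, map_sum, map_rat_smul,
    ← map_pow]

theorem coeff_formalExp_mul {f : PowerSeries R} (hf : PowerSeries.constantCoeff f = 0)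
    (g : PowerSeries R) {n N : ℕ} (hn : n < N) :
    PowerSeries.coeff n (formalExp f * g) =
      ∑ k ∈ Finset.range N, (k.factorial : ℚ)⁻¹ • PowerSeries.coeff n (f ^ k * g) := by
  simp only [PowerSeries.coeff_mul, Finset.smul_sum]
  rw [Finset.sum_comm]
  refine Finset.sum_congr rfl fun p hp => ?_
  rw [coeff_formalExp hf ((Finset.HasAntidiagonal.antidiagonal.fst_le hp).trans_lt hn),
    Finset.sum_mul]
  simp only [smul_mul_assoc]

theorem coeff_mul_formalExp {f : PowerSeries R} (hf : PowerSeries.constantCoeff f = 0)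
    (g : PowerSeries R) {n N : ℕ} (hn : n < N) :
    PowerSeries.coeff n (g * formalExp f) =
      ∑ k ∈ Finset.range N, (k.factorial : ℚ)⁻¹ • PowerSeries.coeff n (g * f ^ k) := by
  simp only [PowerSeries.coeff_mul, Finset.smul_sum]
  rw [Finset.sum_comm]
  refine Finset.sum_congr rfl fun p hp => ?_
  rw [coeff_formalExp hf ((Finset.HasAntidiagonal.antidiagonal.snd_le hp).trans_lt hn),
    Finset.mul_sum]
  simp only [mul_smul_comm]

theorem formalExp_mul_of_commutator {f g c : PowerSeries R}
    (hf : PowerSeries.constantCoeff f = 0) (h : f * g = g * f + c) (hc : Commute f c) :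
    formalExp f * g = (g + c) * formalExp f := by
  ext n
  have hn : n < n + 1 := n.lt_succ_self
  have hfactorial (k : ℕ) :
      ((k + 1).factorial : ℚ)⁻¹ * ((k + 1 : ℕ) : ℚ) = (k.factorial : ℚ)⁻¹ := by
    rw [Nat.factorial_succ, Nat.cast_mul]
    field_simp
  rw [coeff_formalExp_mul hf g (hn.trans n.succ.lt_succ_self), add_mul, map_add,
    coeff_mul_formalExp hf g (hn.trans n.succ.lt_succ_self), coeff_mul_formalExp hf c hn,
    Finset.sum_range_succ', Finset.sum_range_succ' _ (n + 1), add_right_comm,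
    ← Finset.sum_add_distrib]
  congr 1
  · refine Finset.sum_congr rfl fun k _ => ?_
    rw [pow_succ_mul_of_commutator h hc, map_add, smul_add, map_nsmul,
      ← Nat.cast_smul_eq_nsmul ℚ, smul_smul, hfactorial]
  · rw [pow_zero, one_mul, mul_one]

end FormalExp

section CommRing

variable {R : Type*} [CommRing R] [Algebra ℚ R] {f : PowerSeries R}

theorem formalExp_eq_subst (hf : PowerSeries.constantCoeff f = 0) :
    formalExp f = (PowerSeries.exp R).subst f := by
  ext n
  rw [PowerSeries.coeff_subst' (PowerSeries.HasSubst.of_constantCoeff_zero hf),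
    coeff_formalExp hf n.lt_succ_self]
  rw [finsum_eq_sum_of_support_subset (s := Finset.range (n + 1))]
  · refine Finset.sum_congr rfl fun k _ => ?_
    rw [PowerSeries.coeff_exp, algebraMap_smul, one_div]
  · intro k hk
    by_contra hnk
    simp only [Finset.coe_range, Set.mem_Iio, not_lt] at hnk
    exact hk (by simp only [coeff_pow_eq_zero hf hnk, smul_zero])

theorem derivative_formalExp (hf : PowerSeries.constantCoeff f = 0) :
    PowerSeries.derivative R (formalExp f) = formalExp f * PowerSeries.derivative R f := by
  rw [formalExp_eq_subst hf,
    PowerSeries.derivative_subst (PowerSeries.HasSubst.of_constantCoeff_zero hf),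
    PowerSeries.derivative_exp]

theorem eq_one_of_derivative_eq_zero (hf : PowerSeries.constantCoeff f = 1)
    (hD : PowerSeries.derivative R f = 0) : f = 1 :=
  have : IsAddTorsionFree R := IsAddTorsionFree.of_module_rat R
  PowerSeries.derivative.ext (by rw [hD, PowerSeries.derivative_one]) (by rw [hf, map_one])

theorem formalExp_mul_formalExp_neg (hf : PowerSeries.constantCoeff f = 0) :
    formalExp f * formalExp (-f) = 1 := by
  have hf' : PowerSeries.constantCoeff (-f) = 0 := by rw [map_neg, hf, neg_zero]
  apply eq_one_of_derivative_eq_zero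
  · rw [map_mul, constantCoeff_formalExp, constantCoeff_formalExp, mul_one]
  · rw [Derivation.leibniz, derivative_formalExp hf, derivative_formalExp hf', map_neg]
    simp only [smul_eq_mul]
    ring

theorem coeff_mem_of_coeff_formalExp_mem (hf : PowerSeries.constantCoeff f = 0)
    (S : Subalgebra ℚ R) {n : ℕ} (hS : ∀ k ≤ n, PowerSeries.coeff k (formalExp f) ∈ S) {k : ℕ}
    (hk : k ≤ n) : PowerSeries.coeff k f ∈ S := by
  induction k using Nat.strong_induction_on with
  | _ k ih =>
    rcases k with _ | k
    · rw [PowerSeries.coeff_zero_eq_constantCoeff_apply, hf]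
      exact zero_mem S
    have hsucc (m : ℕ) : ((m : R) + 1) ∈ S := add_mem (natCast_mem S m) (one_mem S)
    have hD := congrArg (PowerSeries.coeff k) (derivative_formalExp hf)
    have hmem₀ : (0, k) ∈ Finset.HasAntidiagonal.antidiagonal k := by simp
    rw [PowerSeries.coeff_mul, ← Finset.add_sum_erase _ _ hmem₀,
      PowerSeries.coeff_zero_eq_constantCoeff_apply, constantCoeff_formalExp, one_mul] at hD
    simp only [PowerSeries.coeff_derivative] at hD
    have hmem : PowerSeries.coeff (k + 1) f * ((k : R) + 1) ∈ S := by
      rw [eq_sub_of_add_eq hD.symm]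
      refine sub_mem (mul_mem (hS _ hk) (hsucc k)) (sum_mem fun p hp => ?_)
      obtain ⟨hne, hp⟩ := Finset.mem_erase.mp hp
      have hpk := Finset.HasAntidiagonal.mem_antidiagonal.mp hp
      have hp₁ : p.1 ≠ 0 := fun h => hne (Prod.ext h (by omega))
      exact mul_mem (hS _ (by omega)) (mul_mem (ih _ (by omega) (by omega)) (hsucc p.2))
    have hscalar : ((k : R) + 1) = algebraMap ℚ R (k + 1) := by simp
    rw [hscalar, mul_comm, ← Algebra.smul_def] at hmem
    exact (S.toSubmodule.smul_mem_iff (by positivity)).mp hmem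

end CommRing

/-! ### The vertex operators as translations -/

/-- The translation `x_i ↦ x_i + c z⁻ⁱ / i` of `B`, as a polynomial in `z⁻¹`. -/
noncomputable def translation (c : ℚ) : B →ₐ[ℚ] Polynomial B :=
  MvPolynomial.aeval fun i =>
    Polynomial.C (MvPolynomial.X i) + (c / (i + 1)) • Polynomial.X ^ (i + 1)

theorem constantCoeff_smul_dSeries (c : ℚ) : PowerSeries.constantCoeff (c • dSeries) = 0 := by
  rw [← PowerSeries.coeff_zero_eq_constantCoeff_apply]
  simp [dSeries]

theorem smul_dSeries_mul_C_mulLeft_X (c : ℚ) (i : ℕ) :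
    c • dSeries * PowerSeries.C (LinearMap.mulLeft ℚ (MvPolynomial.X i : B)) =
      PowerSeries.C (LinearMap.mulLeft ℚ (MvPolynomial.X i : B)) * (c • dSeries) +
        (c / (i + 1)) • PowerSeries.X ^ (i + 1) := by
  ext1 n
  refine LinearMap.ext fun p => ?_
  rw [map_add, PowerSeries.coeff_mul_C, PowerSeries.coeff_C_mul]
  simp only [PowerSeries.coeff_smul, PowerSeries.coeff_X_pow, dSeries, PowerSeries.coeff_mk]
  rcases n with _ | n
  · simp
  rcases eq_or_ne n i with rfl | hn
  · simp [Derivation.leibniz, smul_smul, div_eq_mul_inv]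
  · simp [Derivation.leibniz, hn, MvPolynomial.pderiv_X_of_ne hn.symm]

theorem formalExp_smul_dSeries_mul_C_mulLeft_X (c : ℚ) (i : ℕ) :
    formalExp (c • dSeries) * PowerSeries.C (LinearMap.mulLeft ℚ (MvPolynomial.X i : B)) =
      (PowerSeries.C (LinearMap.mulLeft ℚ (MvPolynomial.X i : B)) +
        (c / (i + 1)) • PowerSeries.X ^ (i + 1)) * formalExp (c • dSeries) :=
  formalExp_mul_of_commutator (constantCoeff_smul_dSeries c) (smul_dSeries_mul_C_mulLeft_X c i)
    ((PowerSeries.commute_X_pow _ (i + 1)).smul_right _)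

theorem coeff_formalExp_smul_dSeries_C (c a : ℚ) (n : ℕ) :
    PowerSeries.coeff n (formalExp (c • dSeries)) (MvPolynomial.C a) =
      if n = 0 then MvPolynomial.C a else 0 := by
  have hpow (k : ℕ) :
      PowerSeries.coeff n ((c • dSeries) ^ (k + 1)) (MvPolynomial.C a : B) = 0 := by
    rw [pow_succ, PowerSeries.coeff_mul, LinearMap.sum_apply]
    refine Finset.sum_eq_zero fun p _ => ?_
    rw [Module.End.mul_apply, PowerSeries.coeff_smul, dSeries, PowerSeries.coeff_mk]
    split_ifs <;> simp
  rw [formalExp, PowerSeries.coeff_mk, Finset.sum_range_succ', LinearMap.add_apply,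
    LinearMap.sum_apply]
  simp only [LinearMap.smul_apply, hpow, smul_zero, Finset.sum_const_zero, zero_add, pow_zero,
    PowerSeries.coeff_one]
  split_ifs <;> simp

theorem coeff_formalExp_smul_dSeries (c : ℚ) (τ : B) (n : ℕ) :
    PowerSeries.coeff n (formalExp (c • dSeries)) τ = (translation c τ).coeff n := by
  induction τ using MvPolynomial.induction_on generalizing n with
  | C a =>
    rw [coeff_formalExp_smul_dSeries_C, translation, MvPolynomial.aeval_C,
      IsScalarTower.algebraMap_apply ℚ B, Polynomial.algebraMap_eq, Polynomial.coeff_C,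
      MvPolynomial.algebraMap_eq]
  | add p q hp hq => simp only [map_add, hp, hq, Polynomial.coeff_add]
  | mul_X p i hp =>
    have hcomm := congrArg (fun F : PowerSeries (Module.End ℚ B) => PowerSeries.coeff n F p)
      (formalExp_smul_dSeries_mul_C_mulLeft_X c i)
    simp only [add_mul, smul_mul_assoc, PowerSeries.coeff_mul_C, map_add, PowerSeries.coeff_C_mul,
      PowerSeries.coeff_smul, LinearMap.add_apply, Module.End.mul_apply,
      LinearMap.mulLeft_apply, LinearMap.smul_apply, PowerSeries.coeff_X_pow_mul'] at hcomm
    have hX : translation c (MvPolynomial.X i) =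
        Polynomial.C (MvPolynomial.X i) + (c / (i + 1)) • Polynomial.X ^ (i + 1) :=
      MvPolynomial.aeval_X _ i
    rw [mul_comm, hcomm, map_mul, hX, add_mul, smul_mul_assoc, Polynomial.coeff_add,
      Polynomial.coeff_C_mul, Polynomial.coeff_smul, Polynomial.coeff_X_pow_mul', hp]
    congr 2
    split_ifs
    · exact hp _
    · rfl

section InvZ

variable {R : Type*} [CommRing R]

/-- Substitution of `z⁻¹` for the variable of a polynomial, with values in the Laurent series in
`z`. -/
noncomputable def invZ : Polynomial R →+* LaurentSeries R :=
  Polynomial.eval₂RingHom HahnSeries.C (HahnSeries.single (-1 : ℤ) (1 : R))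

theorem invZ_monomial (n : ℕ) (a : R) :
    invZ (Polynomial.monomial n a) = HahnSeries.single (-(n : ℤ)) a := by
  rw [invZ, Polynomial.coe_eval₂RingHom, Polynomial.eval₂_monomial, HahnSeries.single_pow,
    HahnSeries.C_apply, HahnSeries.single_mul_single]
  simp

theorem coeff_invZ (g : Polynomial R) (k : ℤ) :
    (invZ g).coeff k = if k ≤ 0 then g.coeff (-k).toNat else 0 := by
  induction g using Polynomial.induction_on' with
  | add p q hp hq =>
    rw [map_add, HahnSeries.coeff_add, hp, hq, Polynomial.coeff_add]
    split_ifs <;> simp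
  | monomial n a =>
    rw [invZ_monomial, HahnSeries.coeff_single, Polynomial.coeff_monomial]
    split_ifs <;> first | rfl | omega

theorem map_invZ {S : Type*} [CommRing S] (φ : R →+* S) (g : Polynomial R) :
    (invZ g).map φ = invZ (g.map φ) := by
  ext k
  rw [HahnSeries.map_coeff, coeff_invZ, coeff_invZ, apply_ite φ, map_zero, Polynomial.coeff_map]

theorem map_ofPowerSeries {S : Type*} [CommRing S] (φ : R →+* S) (F : PowerSeries R) :
    (HahnSeries.ofPowerSeries ℤ R F).map φ =
      HahnSeries.ofPowerSeries ℤ S (PowerSeries.map φ F) := by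
  ext k
  rw [HahnSeries.map_coeff, PowerSeries.coeff_coe, PowerSeries.coeff_coe, apply_ite φ, map_zero,
    PowerSeries.coeff_map]

end InvZ

theorem expD_eq_invZ_translation (c : ℚ) (τ : B) : expD c τ = invZ (translation c τ) := by
  ext1
  funext k
  rw [coeff_invZ, ← coeff_formalExp_smul_dSeries]
  rfl

/-! ### Miwa variables -/

theorem derivation_prod_of_eq_mul {ι R A : Type*} [CommRing R] [CommRing A] [Algebra R A]
    (D : Derivation R A A) (s : Finset ι) (u a : ι → A) (h : ∀ i ∈ s, D (u i) = u i * a i) :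
    D (∏ i ∈ s, u i) = (∏ i ∈ s, u i) * ∑ i ∈ s, a i := by
  classical
  induction s using Finset.induction_on with
  | empty => simp
  | insert i s hi ih =>
    rw [Finset.prod_insert hi, Finset.sum_insert hi, Derivation.leibniz,
      ih fun j hj => h j (Finset.mem_insert_of_mem hj), h i (Finset.mem_insert_self i s)]
    simp only [smul_eq_mul]
    ring

theorem one_sub_C_mul_X_mul_mk_pow {K : Type*} [CommRing K] (t : K) :
    (1 - PowerSeries.C t * PowerSeries.X) * PowerSeries.mk (t ^ ·) = 1 := by
  have h := congrArg (PowerSeries.rescale t) (PowerSeries.mk_one_mul_one_sub_eq_one K)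
  simpa only [map_mul, map_sub, map_one, PowerSeries.rescale_X, PowerSeries.rescale_mk,
    Pi.one_apply, mul_one, mul_comm] using h

theorem derivative_prod_one_sub_C_mul_X {ι K : Type*} [Fintype ι] [CommRing K] (y : ι → K) :
    PowerSeries.derivative K (∏ j, (1 - PowerSeries.C (y j) * PowerSeries.X)) =
      (∏ j, (1 - PowerSeries.C (y j) * PowerSeries.X)) *
        ∑ j, -(PowerSeries.C (y j) * PowerSeries.mk (y j ^ ·)) := by
  refine derivation_prod_of_eq_mul _ _ _ _ fun j _ => ?_
  rw [mul_neg, mul_left_comm, one_sub_C_mul_X_mul_mk_pow]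
  simp

section Miwa

variable {ι K : Type*} [Fintype ι] [CommRing K] [Algebra ℚ K]

/-- The specialization `x_i = (∑_j y_jⁱ) / i` of `B` at a finite family of points `y`. -/
noncomputable def miwa (y : ι → K) : B →ₐ[ℚ] K :=
  MvPolynomial.aeval fun i => ((i : ℚ) + 1)⁻¹ • ∑ j, y j ^ (i + 1)

theorem miwa_X (y : ι → K) (i : ℕ) :
    miwa y (MvPolynomial.X i) = ((i : ℚ) + 1)⁻¹ • ∑ j, y j ^ (i + 1) :=
  MvPolynomial.aeval_X _ i

theorem miwa_comp_perm (y : ι → K) (σ : Equiv.Perm ι) : miwa (y ∘ σ) = miwa y := by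
  ext i
  simp only [miwa_X, Function.comp_apply]
  rw [Equiv.sum_comp σ fun j => y j ^ (i + 1)]

theorem map_miwa {L : Type*} [CommRing L] [Algebra ℚ L] (φ : K →ₐ[ℚ] L) (y : ι → K) (τ : B) :
    φ (miwa y τ) = miwa (φ ∘ y) τ := by
  suffices φ.comp (miwa y) = miwa (φ ∘ y) from DFunLike.congr_fun this τ
  ext i
  simp only [AlgHom.comp_apply, miwa_X, map_smul, map_sum, map_pow, Function.comp_apply]

theorem eval_map_translation {φ ψ : B →ₐ[ℚ] K} {c : ℚ}
    {t : K} (h : ∀ i, ψ (MvPolynomial.X i) =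
      φ (MvPolynomial.X i) + (c / ((i : ℚ) + 1)) • t ^ (i + 1)) (τ : B) :
    ((translation c τ).map (φ : B →+* K)).eval t = ψ τ := by
  suffices ((Polynomial.aeval t).restrictScalars ℚ).comp
      ((Polynomial.mapAlgHom φ).comp (translation c)) = ψ from DFunLike.congr_fun this τ
  refine MvPolynomial.algHom_ext fun i => ?_
  have hsmul : (((c / (i + 1)) • Polynomial.X ^ (i + 1) : Polynomial B).map
      (φ : B →+* K)).eval t = (c / ((i : ℚ) + 1)) • t ^ (i + 1) := by
    rw [← Polynomial.coe_mapRingHom, map_rat_smul, ← Polynomial.coe_evalRingHom, map_rat_smul]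
    simp
  rw [h, ← hsmul]
  simp [translation]

theorem eval_map_miwa_translation_one {n : ℕ} (z : Fin n → K) (t : K) (τ : B) :
    ((translation 1 τ).map (miwa z : B →+* K)).eval t =
      miwa (Fin.cons t z : Fin (n + 1) → K) τ := by
  refine eval_map_translation (fun i => ?_) τ
  rw [miwa_X, miwa_X, Fin.sum_univ_succ]
  simp only [Fin.cons_zero, Fin.cons_succ, smul_add, one_div, add_comm]

theorem eval_map_miwa_translation_neg_one {n : ℕ} (w : Fin (n + 1) → K) (j : Fin (n + 1))
    (τ : B) :
    ((translation (-1) τ).map (miwa w : B →+* K)).eval (w j) = miwa (w ∘ j.succAbove) τ := by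
  refine eval_map_translation (fun i => ?_) τ
  rw [miwa_X, miwa_X, Fin.sum_univ_succAbove _ j, smul_add, neg_div, neg_smul, one_div]
  exact (add_neg_cancel_comm _ _).symm

theorem constantCoeff_xSeries : PowerSeries.constantCoeff xSeries = 0 := by
  rw [← PowerSeries.coeff_zero_eq_constantCoeff_apply]
  simp [xSeries]

theorem constantCoeff_map_xSeries (φ : B →ₐ[ℚ] K) :
    PowerSeries.constantCoeff (PowerSeries.map (φ : B →+* K) xSeries) = 0 := by
  rw [← PowerSeries.coeff_zero_eq_constantCoeff_apply, PowerSeries.coeff_map,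
    PowerSeries.coeff_zero_eq_constantCoeff_apply, constantCoeff_xSeries, map_zero]

theorem derivative_map_miwa_xSeries (y : ι → K) :
    PowerSeries.derivative K (PowerSeries.map (miwa y : B →+* K) xSeries) =
      ∑ j, PowerSeries.C (y j) * PowerSeries.mk (y j ^ ·) := by
  ext n
  have hn : ((n : K) + 1) = algebraMap ℚ K (n + 1) := by simp
  rw [PowerSeries.coeff_derivative, PowerSeries.coeff_map, xSeries, PowerSeries.coeff_mk,
    if_neg n.succ_ne_zero, Nat.add_sub_cancel, RingHom.coe_coe, miwa_X, hn, ← Algebra.commutes,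
    ← Algebra.smul_def, smul_inv_smul₀ (by positivity), map_sum]
  simp only [PowerSeries.coeff_C_mul, PowerSeries.coeff_mk, pow_succ']

theorem map_miwa_formalExp_xSeries_mul_prod (y : ι → K) :
    PowerSeries.map (miwa y : B →+* K) (formalExp xSeries) *
      ∏ j, (1 - PowerSeries.C (y j) * PowerSeries.X) = 1 := by
  rw [map_formalExp]
  apply eq_one_of_derivative_eq_zero
  · simp [constantCoeff_formalExp]
  · rw [Derivation.leibniz, derivative_formalExp (constantCoeff_map_xSeries _),
      derivative_prod_one_sub_C_mul_X, derivative_map_miwa_xSeries, Finset.sum_neg_distrib]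
    simp only [smul_eq_mul]
    ring

theorem map_miwa_formalExp_neg_xSeries (y : ι → K) :
    PowerSeries.map (miwa y : B →+* K) (formalExp (-xSeries)) =
      ∏ j, (1 - PowerSeries.C (y j) * PowerSeries.X) := by
  refine left_inv_eq_right_inv ?_ (map_miwa_formalExp_xSeries_mul_prod y)
  rw [mul_comm, ← map_mul, formalExp_mul_formalExp_neg constantCoeff_xSeries, map_one]

end Miwa

/-! ### The bilinear residue in Miwa variables -/

theorem productMap_residue_laurentTensor {K : Type*} [CommRing K] [Algebra ℚ K] (φ ψ : B →ₐ[ℚ] K)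
    (u v : LaurentSeries B) :
    Algebra.TensorProduct.productMap φ ψ (residue (laurentTensor u v)) =
      (u.map (φ : B →+* K) * v.map (ψ : B →+* K)).coeff (-1) := by
  let Φ : B ⊗[ℚ] B →+* K := Algebra.TensorProduct.productMap φ ψ
  have hu : (u.map (Algebra.TensorProduct.includeLeft : B →ₐ[ℚ] B ⊗[ℚ] B)).map Φ =
      u.map (φ : B →+* K) := by
    ext k
    simp [Φ]
  have hv : (v.map (Algebra.TensorProduct.includeRight : B →ₐ[ℚ] B ⊗[ℚ] B)).map Φ =
      v.map (ψ : B →+* K) := by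
    ext k
    simp [Φ]
  have hmul := HahnSeries.map_mul (Φ : B ⊗[ℚ] B →ₙ+* K)
    (x := u.map (Algebra.TensorProduct.includeLeft : B →ₐ[ℚ] B ⊗[ℚ] B))
    (y := v.map (Algebra.TensorProduct.includeRight : B →ₐ[ℚ] B ⊗[ℚ] B))
  rw [← hu, ← hv]
  exact congrArg (HahnSeries.coeff · (-1)) hmul

theorem map_ofPowerSeries_mul_expD {K : Type*} [CommRing K] [Algebra ℚ K] (φ : B →ₐ[ℚ] K)
    (F : PowerSeries B) (c : ℚ) (τ : B) :
    (HahnSeries.ofPowerSeries ℤ B F * expD c τ).map (φ : B →+* K) =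
      HahnSeries.ofPowerSeries ℤ K (PowerSeries.map (φ : B →+* K) F) *
        invZ ((translation c τ).map (φ : B →+* K)) := by
  rw [expD_eq_invZ_translation, ← map_invZ, ← map_ofPowerSeries]
  exact HahnSeries.map_mul (φ : B →ₙ+* K)

section Residue

variable {ι R : Type*} [Fintype ι] [CommRing R]

theorem ofPowerSeries_prod_one_sub_C_mul_X (y : ι → R) :
    HahnSeries.ofPowerSeries ℤ R (∏ j, (1 - PowerSeries.C (y j) * PowerSeries.X)) =
      HahnSeries.single (Fintype.card ι : ℤ) 1 * invZ (Lagrange.nodal Finset.univ y) := by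
  have hX : HahnSeries.single (1 : ℤ) (1 : R) * invZ Polynomial.X = 1 := by
    rw [← Polynomial.monomial_one_one_eq_X, invZ_monomial, HahnSeries.single_mul_single]
    simp
  have hC (a : R) : invZ (Polynomial.C a) = HahnSeries.C a := by
    simp [invZ]
  have hcard : HahnSeries.single (Fintype.card ι : ℤ) (1 : R) =
      ∏ _j : ι, HahnSeries.single (1 : ℤ) (1 : R) := by
    simp [HahnSeries.single_pow]
  rw [hcard, Lagrange.nodal, map_prod, map_prod, ← Finset.prod_mul_distrib]
  refine Finset.prod_congr rfl fun j _ => ?_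
  rw [map_sub, map_sub, mul_sub, hX, hC, map_one, map_mul, HahnSeries.ofPowerSeries_C,
    HahnSeries.ofPowerSeries_X, mul_comm]

theorem coeff_invZ_mul_ofPowerSeries {r : Polynomial R} {N : ℕ} (hr : r.natDegree ≤ N)
    (F : PowerSeries R) :
    (invZ r * HahnSeries.ofPowerSeries ℤ R F).coeff (-N) =
      r.coeff N * PowerSeries.constantCoeff F := by
  conv_lhs => rw [r.as_sum_range' (N + 1) (by omega), map_sum, Finset.sum_mul]
  rw [HahnSeries.coeff_sum, Finset.sum_eq_single_of_mem N (by simp)]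
  · rw [invZ_monomial, HahnSeries.coeff_single_mul, sub_self]
    simp [PowerSeries.coeff_coe]
  · intro i hi hiN
    rw [invZ_monomial, HahnSeries.coeff_single_mul, PowerSeries.coeff_coe, if_pos (by grind),
      mul_zero]

/-- The coefficient is the residue at infinity of `P(t) / ∏ (t - w k)`, here read off from the
remainder of `P` modulo the denominator. -/
theorem coeff_invZ_mul_eq_coeff_modByMonic [Nontrivial R] {w : ι → R} {F : PowerSeries R}
    (P : Polynomial R) {m : ℕ} (hm : Fintype.card ι = m + 1)
    (hF : F * ∏ k, (1 - PowerSeries.C (w k) * PowerSeries.X) = 1) :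
    (invZ P * HahnSeries.ofPowerSeries ℤ R F).coeff (-m) =
      (P %ₘ Lagrange.nodal Finset.univ w).coeff m := by
  set f := Lagrange.nodal Finset.univ w
  have hf : f.Monic := Lagrange.nodal_monic
  have hpole : invZ f * HahnSeries.ofPowerSeries ℤ R F = HahnSeries.single (-(m + 1) : ℤ) 1 := by
    have hone := congrArg (HahnSeries.ofPowerSeries ℤ R) hF
    rw [map_mul, map_one, ofPowerSeries_prod_one_sub_C_mul_X, hm] at hone
    have hcancel : HahnSeries.single (-(m + 1) : ℤ) (1 : R) *
        HahnSeries.single ((m + 1 : ℕ) : ℤ) 1 = 1 := by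
      rw [HahnSeries.single_mul_single]
      simp
    linear_combination HahnSeries.single (-(m + 1) : ℤ) (1 : R) * hone -
      invZ f * HahnSeries.ofPowerSeries ℤ R F * hcancel
  have hF₀ : PowerSeries.constantCoeff F = 1 := by
    simpa using congrArg PowerSeries.constantCoeff hF
  have hdeg : (P %ₘ f).natDegree ≤ m := by
    have hcard : f.natDegree = m + 1 := Lagrange.natDegree_nodal.trans (by simp [hm])
    have hne : f ≠ 1 := fun h => by simp [h] at hcard
    exact Nat.le_of_lt_succ ((Polynomial.natDegree_modByMonic_lt P hf hne).trans_eq hcard)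
  conv_lhs => rw [← P.modByMonic_add_div f]
  rw [map_add, map_mul, add_mul, HahnSeries.coeff_add, coeff_invZ_mul_ofPowerSeries hdeg, hF₀,
    mul_one, mul_right_comm, hpole, HahnSeries.coeff_single_mul, coeff_invZ, if_neg (by omega)]
  simp

end Residue

theorem coeff_modByMonic_nodal {K κ : Type*} [Field K] [Fintype κ] [DecidableEq κ] {w : κ → K}
    (hw : Function.Injective w) {m : ℕ} (hm : Fintype.card κ = m + 1) (P : Polynomial K) :
    (P %ₘ Lagrange.nodal Finset.univ w).coeff m =
      ∑ j, P.eval (w j) / ∏ k ∈ Finset.univ.erase j, (w j - w k) := by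
  have hdeg : (P %ₘ Lagrange.nodal Finset.univ w).degree < (Finset.univ : Finset κ).card := by
    simpa only [Lagrange.degree_nodal] using P.degree_modByMonic_lt Lagrange.nodal_monic
  have hcoeff := Lagrange.coeff_eq_sum hw.injOn hdeg
  rw [Finset.card_univ, hm, Nat.add_sub_cancel] at hcoeff
  rw [hcoeff]
  refine Finset.sum_congr rfl fun j _ => ?_
  have hroot : (Lagrange.nodal Finset.univ w).eval (w j) = 0 :=
    Lagrange.eval_nodal_at_node (Finset.mem_univ j)
  conv_rhs => rw [← P.modByMonic_add_div (Lagrange.nodal Finset.univ w)]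
  rw [Polynomial.eval_add, Polynomial.eval_mul, hroot, zero_mul, add_zero]

theorem productMap_miwa_residue {K : Type*} [Field K] [Algebra ℚ K] {n : ℕ} (z : Fin n → K)
    {w : Fin (n + 2) → K} (hw : Function.Injective w) (τ : B) :
    Algebra.TensorProduct.productMap (miwa z) (miwa w)
        (residue (laurentTensor (GamStar τ) (Gam τ))) =
      ∑ j, (∏ b, (w j - z b)) / (∏ k ∈ Finset.univ.erase j, (w j - w k)) *
        (miwa (Fin.cons (w j) z : Fin (n + 1) → K) τ * miwa (w ∘ j.succAbove) τ) := by
  set u := (translation 1 τ).map (miwa z : B →+* K)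
  set v := (translation (-1) τ).map (miwa w : B →+* K)
  set F := PowerSeries.map (miwa w : B →+* K) (formalExp xSeries)
  have hF : F * ∏ k, (1 - PowerSeries.C (w k) * PowerSeries.X) = 1 :=
    map_miwa_formalExp_xSeries_mul_prod w
  have hproduct : (GamStar τ).map (miwa z : B →+* K) * (Gam τ).map (miwa w : B →+* K) =
      HahnSeries.single (n : ℤ) 1 * (invZ (Lagrange.nodal Finset.univ z * (u * v)) *
        HahnSeries.ofPowerSeries ℤ K F) := by
    rw [GamStar, Gam, map_ofPowerSeries_mul_expD, map_ofPowerSeries_mul_expD,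
      map_miwa_formalExp_neg_xSeries, ofPowerSeries_prod_one_sub_C_mul_X, map_mul, map_mul,
      Fintype.card_fin]
    ring
  rw [productMap_residue_laurentTensor, hproduct, HahnSeries.coeff_single_mul, one_mul,
    show (-1 - n : ℤ) = -((n + 1 : ℕ) : ℤ) by push_cast; ring,
    coeff_invZ_mul_eq_coeff_modByMonic _ (Fintype.card_fin _) hF,
    coeff_modByMonic_nodal hw (Fintype.card_fin _)]
  refine Finset.sum_congr rfl fun j _ => ?_
  rw [Polynomial.eval_mul, Polynomial.eval_mul, Lagrange.eval_nodal,
    eval_map_miwa_translation_one, eval_map_miwa_translation_neg_one, mul_div_right_comm]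

/-! ### Plücker relations for functions of several points -/

section Plucker

variable {n : ℕ} {T R : Type*} [CommRing R]

/-- The left-hand side of the Plücker relation for a function `A` of `n + 1` points, with `n`
points `z` on one side and `n + 2` points `w` on the other. -/
def pluckerSum (A : (Fin (n + 1) → T) → R) (z : Fin n → T) (w : Fin (n + 2) → T) : R :=
  ∑ j : Fin (n + 2), (-1) ^ (j : ℕ) * (A (Fin.cons (w j) z) * A (w ∘ j.succAbove))

/-- `A` has the formal properties of the determinants `det (f_i (y_j))` as a function of the points
`y`: it is alternating, and it satisfies the Plücker relations (at distinct points `w`). -/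
structure IsPlucker (A : (Fin (n + 1) → T) → R) : Prop where
  eq_zero_of_not_injective : ∀ y, ¬ Function.Injective y → A y = 0
  comp_perm : ∀ y (σ : Equiv.Perm (Fin (n + 1))), A (y ∘ σ) = (Equiv.Perm.sign σ : ℤ) * A y
  pluckerSum_eq_zero : ∀ z w, Function.Injective w → pluckerSum A z w = 0

theorem det_of_comp_perm {ι : Type*} [Fintype ι] [DecidableEq ι] (f : ι → T → R) (y : ι → T)
    (σ : Equiv.Perm ι) :
    (Matrix.of fun i j => f i ((y ∘ σ) j)).det =
      (Equiv.Perm.sign σ : ℤ) * (Matrix.of fun i j => f i (y j)).det := by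
  rw [← Matrix.det_permute']
  rfl

theorem det_of_not_injective {ι : Type*} [Fintype ι] [DecidableEq ι] (f : ι → T → R) {y : ι → T}
    (hy : ¬ Function.Injective y) : (Matrix.of fun i j => f i (y j)).det = 0 := by
  obtain ⟨j, k, hjk, hne⟩ := Function.not_injective_iff.mp hy
  exact Matrix.det_zero_of_column_eq hne fun i => by simp [hjk]

theorem sum_mul_det_comp_succAbove (f : Fin (n + 1) → T → R) (w : Fin (n + 2) → T)
    (i : Fin (n + 1)) :
    ∑ j : Fin (n + 2), (-1) ^ (j : ℕ) *
      (f i (w j) * (Matrix.of fun k l => f k (w (j.succAbove l))).det) = 0 := by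
  let N : Matrix (Fin (n + 2)) (Fin (n + 2)) R :=
    Matrix.of (Fin.cons (fun j => f i (w j)) fun k j => f k (w j))
  have hN : N.det = 0 := Matrix.det_zero_of_row_eq (Fin.succ_ne_zero i).symm rfl
  rw [← hN, Matrix.det_succ_row_zero]
  exact Finset.sum_congr rfl fun j _ => (mul_assoc _ _ _).symm

theorem pluckerSum_det (f : Fin (n + 1) → T → R) (z : Fin n → T) (w : Fin (n + 2) → T) :
    pluckerSum (fun y => (Matrix.of fun i j => f i (y j)).det) z w = 0 := by
  have hexpand (t : T) : (Matrix.of fun i j => f i (Fin.cons (α := fun _ => T) t z j)).det =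
      ∑ i : Fin (n + 1), (-1) ^ (i : ℕ) * f i t *
        (Matrix.of fun k l => f (i.succAbove k) (z l)).det := by
    rw [Matrix.det_succ_column_zero]
    rfl
  simp only [pluckerSum, hexpand, Finset.sum_mul, Finset.mul_sum, Function.comp_apply]
  rw [Finset.sum_comm]
  refine Finset.sum_eq_zero fun i _ => ?_
  calc _ = (-1) ^ (i : ℕ) * (Matrix.of fun k l => f (i.succAbove k) (z l)).det *
        ∑ j : Fin (n + 2), (-1) ^ (j : ℕ) *
          (f i (w j) * (Matrix.of fun k l => f k (w (j.succAbove l))).det) := by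
        rw [Finset.mul_sum]
        exact Finset.sum_congr rfl fun j _ => by ring
    _ = 0 := by rw [sum_mul_det_comp_succAbove, mul_zero]

theorem isPlucker_det (f : Fin (n + 1) → T → R) :
    IsPlucker fun y => (Matrix.of fun i j => f i (y j)).det where
  eq_zero_of_not_injective _ hy := det_of_not_injective f hy
  comp_perm y σ := det_of_comp_perm f y σ
  pluckerSum_eq_zero z w _ := pluckerSum_det f z w

namespace IsPlucker

variable {A : (Fin (n + 1) → T) → R}

theorem const_mul (hA : IsPlucker A) (c : R) : IsPlucker fun y => c * A y where
  eq_zero_of_not_injective y hy := by rw [hA.eq_zero_of_not_injective y hy, mul_zero]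
  comp_perm y σ := by rw [hA.comp_perm, mul_left_comm]
  pluckerSum_eq_zero z w hw := by
    rw [pluckerSum, ← mul_zero (c ^ 2), ← hA.pluckerSum_eq_zero z w hw, pluckerSum, Finset.mul_sum]
    exact Finset.sum_congr rfl fun j _ => by ring

theorem apply_cons_comp_succAbove (hA : IsPlucker A) (y : Fin (n + 1) → T) (a : Fin (n + 1))
    (t : T) :
    A (Fin.cons t (y ∘ a.succAbove) : Fin (n + 1) → T) =
      (-1) ^ (a : ℕ) * A (Function.update y a t) := by
  have hcons : (Fin.cons t (y ∘ a.succAbove) : Fin (n + 1) → T) =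
      Function.update y a t ∘ a.cycleRange.symm := by
    ext k
    cases k using Fin.cases <;> simp
  rw [hcons, hA.comp_perm, Equiv.Perm.sign_symm, Fin.sign_cycleRange]
  simp

theorem exchange (hA : IsPlucker A) {y₀ y : Fin (n + 1) → T} (hy : Function.Injective y)
    {a : Fin (n + 1)} (ha : y₀ a ∉ Set.range y) :
    A y₀ * A y = ∑ j, A (Function.update y₀ a (y j)) * A (Function.update y j (y₀ a)) := by
  have hterm (j : Fin (n + 1)) : (Fin.cons (y₀ a) y : Fin (n + 2) → T) ∘ j.succ.succAbove =
      Fin.cons (y₀ a) (y ∘ j.succAbove) := by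
    ext k
    cases k using Fin.cases <;> simp
  have hsum := hA.pluckerSum_eq_zero (y₀ ∘ a.succAbove) (Fin.cons (y₀ a) y)
    (Fin.cons_injective_iff.mpr ⟨ha, hy⟩)
  have hsign (m : ℕ) : ((-1 : R) ^ m) * (-1) ^ m = 1 := by rw [← mul_pow]; simp
  rw [pluckerSum, Fin.sum_univ_succ] at hsum
  simp only [Fin.cons_zero, Fin.cons_succ, Fin.succAbove_zero, hterm,
    hA.apply_cons_comp_succAbove, Function.update_eq_self, Fin.val_zero, Fin.val_succ] at hsum
  rw [show (Fin.cons (y₀ a) y : Fin (n + 2) → T) ∘ Fin.succ = y from rfl] at hsum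
  rw [← sub_eq_zero, ← mul_zero ((-1) ^ (a : ℕ)), ← hsum, mul_add, Finset.mul_sum, sub_eq_add_neg,
    ← Finset.sum_neg_distrib]
  congr 1
  · linear_combination (- A y₀ * A y) * hsign a
  · refine Finset.sum_congr rfl fun j _ => ?_
    linear_combination (A (Function.update y₀ a (y j)) * A (Function.update y j (y₀ a))) *
      ((-1) ^ (j : ℕ) * (-1) ^ (j : ℕ) * hsign a + hsign j)

end IsPlucker

end Plucker

theorem ncard_notMem_range_update_lt {ι T : Type*} [Finite ι] [DecidableEq ι] {y₀ y : ι → T}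
    {a j : ι} (ha : y₀ a ∉ Set.range y) (hj : Function.Injective (Function.update y₀ a (y j))) :
    {b | y₀ b ∉ Set.range (Function.update y j (y₀ a))}.ncard < {b | y₀ b ∉ Set.range y}.ncard := by
  have hsubset : {b | y₀ b ∉ Set.range (Function.update y j (y₀ a))} ⊆
      {b | y₀ b ∉ Set.range y} := by
    rintro b hb ⟨k, hk⟩
    rcases eq_or_ne k j with rfl | hkj
    · have hba : b ≠ a := fun h => ha ⟨k, h ▸ hk⟩
      exact hba (hj (by rw [Function.update_of_ne hba, Function.update_self, hk]))
    · exact hb ⟨k, by rw [Function.update_of_ne hkj, hk]⟩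
  refine Set.ncard_lt_ncard ((Set.ssubset_iff_of_subset hsubset).mpr ⟨a, ha, ?_⟩)
  exact fun h => h ⟨j, Function.update_self ..⟩

theorem exists_perm_eq_comp {ι T : Type*} [Finite ι] {y₀ y : ι → T}
    (hy₀ : Function.Injective y₀) (h : ∀ b, y₀ b ∈ Set.range y) :
    ∃ σ : Equiv.Perm ι, y₀ = y ∘ σ := by
  choose σ hσ using h
  have hσ_inj : Function.Injective σ := fun b c hbc => hy₀ (by rw [← hσ, ← hσ, hbc])
  exact ⟨Equiv.ofBijective σ (Finite.injective_iff_bijective.mp hσ_inj),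
    funext fun b => (hσ b).symm⟩

namespace IsPlucker

theorem eq_of_eq_on_updates {n : ℕ} {T R : Type*} [CommRing R] [IsDomain R]
    {A D : (Fin (n + 1) → T) → R} (hA : IsPlucker A) (hD : IsPlucker D) {y₀ : Fin (n + 1) → T}
    (h₀ : A y₀ ≠ 0)
    (h : ∀ a t, A (Function.update y₀ a t) = D (Function.update y₀ a t)) :
    A = D := by
  funext y
  -- The exchange relation moves one more of the points of `y₀` into `y`.
  induction hc : {b | y₀ b ∉ Set.range y}.ncard using Nat.strong_induction_on generalizing y with
  | _ c ih =>
  subst hc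
  have hy₀ : A y₀ = D y₀ := by simpa using h 0 (y₀ 0)
  by_cases hy : Function.Injective y
  swap
  · rw [hA.eq_zero_of_not_injective y hy, hD.eq_zero_of_not_injective y hy]
  by_cases hrange : ∀ b, y₀ b ∈ Set.range y
  · have hinj : Function.Injective y₀ := not_not.mp (mt (hA.eq_zero_of_not_injective y₀) h₀)
    obtain ⟨σ, rfl⟩ := exists_perm_eq_comp hinj hrange
    rw [hA.comp_perm, hD.comp_perm] at hy₀
    refine mul_left_cancel₀ ?_ hy₀
    rw [hA.comp_perm] at h₀
    exact left_ne_zero_of_mul h₀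
  · push Not at hrange
    obtain ⟨a, ha⟩ := hrange
    refine mul_left_cancel₀ h₀ ?_
    conv_rhs => rw [hy₀]
    rw [hA.exchange hy ha, hD.exchange hy ha]
    refine Finset.sum_congr rfl fun j _ => ?_
    rw [← h]
    by_cases hj : Function.Injective (Function.update y₀ a (y j))
    · rw [ih _ (ncard_notMem_range_update_lt ha hj) _ rfl]
    · rw [hA.eq_zero_of_not_injective _ hj, zero_mul, zero_mul]

theorem eq_mul_det {n : ℕ} {T K : Type*} [Field K] {A : (Fin (n + 1) → T) → K} (hA : IsPlucker A)
    {y₀ : Fin (n + 1) → T} (h₀ : A y₀ ≠ 0) (y : Fin (n + 1) → T) :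
    A y = A y₀ * (Matrix.of fun i j => A (Function.update y₀ i (y j)) / A y₀).det := by
  let f : Fin (n + 1) → T → K := fun i t => A (Function.update y₀ i t) / A y₀
  have hone : (Matrix.of fun i j => f i (y₀ j)) = 1 := by
    ext i j
    rcases eq_or_ne i j with rfl | hij
    · simp [f, h₀]
    · have hninj : ¬ Function.Injective (Function.update y₀ i (y₀ j)) := fun hinj =>
        hij (hinj (by rw [Function.update_self, Function.update_of_ne hij.symm]))
      simp [f, hA.eq_zero_of_not_injective _ hninj, hij]
  refine congrFun (hA.eq_of_eq_on_updates ((isPlucker_det f).const_mul (A y₀)) h₀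
    fun a t => ?_) y
  have hcol : (Matrix.of fun i k => f i (Function.update y₀ a t k)) =
      (1 : Matrix (Fin (n + 1)) (Fin (n + 1)) K).updateCol a fun i => f i t := by
    rw [← hone]
    ext i k
    rw [Matrix.updateCol_apply, Matrix.of_apply, Function.update_apply]
    split_ifs <;> rfl
  rw [hcol, ← Matrix.cramer_apply, Matrix.cramer_one]
  exact (mul_div_cancel₀ _ h₀).symm

end IsPlucker

/-! ### The Hirota residue as a Plücker sum -/

theorem prod_erase_eq_prod_succAbove {n : ℕ} {R : Type*} [CommMonoid R] (j : Fin (n + 1))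
    (f : Fin (n + 1) → R) : ∏ k ∈ Finset.univ.erase j, f k = ∏ k, f (j.succAbove k) := by
  rw [Fin.univ_succAbove n j, Finset.erase_cons, Finset.prod_map]
  rfl

section Vandermonde

variable {n : ℕ} {R : Type*} [CommRing R]

theorem det_vandermonde_comp_perm (y : Fin n → R) (σ : Equiv.Perm (Fin n)) :
    (Matrix.vandermonde (y ∘ σ)).det =
      (Equiv.Perm.sign σ : ℤ) * (Matrix.vandermonde y).det := by
  rw [← Matrix.det_permute]
  rfl

theorem det_vandermonde_cons (t : R) (z : Fin n → R) :
    (Matrix.vandermonde (Fin.cons t z : Fin (n + 1) → R)).det =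
      (∏ b, (z b - t)) * (Matrix.vandermonde z).det := by
  simp only [Matrix.det_vandermonde, Fin.prod_univ_succ, Fin.prod_Ioi_zero, Fin.prod_Ioi_succ,
    Fin.cons_zero, Fin.cons_succ]

theorem det_vandermonde_eq_mul_comp_succAbove (w : Fin (n + 1) → R) (j : Fin (n + 1)) :
    (Matrix.vandermonde w).det = (-1) ^ (j : ℕ) *
      ((∏ k, (w (j.succAbove k) - w j)) * (Matrix.vandermonde (w ∘ j.succAbove)).det) := by
  have hcons : (Fin.cons (w j) (w ∘ j.succAbove) : Fin (n + 1) → R) = w ∘ j.cycleRange.symm :=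
    Fin.cons_removeNth_eq_comp_cycleRange_symm w j
  have hdet := det_vandermonde_cons (w j) (w ∘ j.succAbove)
  rw [hcons, det_vandermonde_comp_perm, Equiv.Perm.sign_symm, Fin.sign_cycleRange] at hdet
  simp only [Function.comp_apply] at hdet
  rw [← hdet, ← mul_assoc]
  push_cast
  rw [← mul_pow]
  simp

end Vandermonde

section Alternant

variable {R : Type*} [CommRing R] [Algebra ℚ R]

/-- The alternating function of `s` points whose quotient by the Vandermonde determinant is `τ` in
Miwa variables. -/
noncomputable def alternant (τ : B) {s : ℕ} (y : Fin s → R) : R :=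
  (Matrix.vandermonde y).det * miwa y τ

theorem alternant_of_not_injective [IsDomain R] (τ : B) {s : ℕ} {y : Fin s → R}
    (hy : ¬ Function.Injective y) : alternant τ y = 0 := by
  rw [alternant, not_not.mp (mt Matrix.det_vandermonde_ne_zero_iff.mp hy), zero_mul]

theorem alternant_comp_perm (τ : B) {s : ℕ} (y : Fin s → R) (σ : Equiv.Perm (Fin s)) :
    alternant τ (y ∘ σ) = (Equiv.Perm.sign σ : ℤ) * alternant τ y := by
  rw [alternant, alternant, det_vandermonde_comp_perm, miwa_comp_perm, mul_assoc]

theorem map_alternant {S : Type*} [CommRing S] [Algebra ℚ S] (φ : R →ₐ[ℚ] S) (τ : B) {s : ℕ}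
    (y : Fin s → R) : φ (alternant τ y) = alternant τ (φ ∘ y) := by
  have hdet : φ (Matrix.vandermonde y).det = (Matrix.vandermonde (φ ∘ y)).det := by
    rw [AlgHom.map_det, AlgHom.mapMatrix_apply]
    congr 1
    ext i j
    simp [Matrix.vandermonde_apply]
  rw [alternant, alternant, map_mul, hdet, map_miwa]

end Alternant

section Residue

variable {n : ℕ} {K : Type*} [Field K] [Algebra ℚ K]

theorem pluckerSum_alternant (τ : B) (z : Fin n → K) {w : Fin (n + 2) → K}
    (hw : Function.Injective w) :
    pluckerSum (alternant τ) z w =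
      -((Matrix.vandermonde z).det * (Matrix.vandermonde w).det *
        Algebra.TensorProduct.productMap (miwa z) (miwa w)
          (residue (laurentTensor (GamStar τ) (Gam τ)))) := by
  rw [productMap_miwa_residue z hw, pluckerSum, Finset.mul_sum, ← Finset.sum_neg_distrib]
  refine Finset.sum_congr rfl fun j _ => ?_
  have hnum : ∏ b, (w j - z b) = (-1) ^ n * ∏ b, (z b - w j) := by
    simp_rw [fun b => (neg_sub (z b) (w j)).symm, Finset.prod_neg, Finset.card_univ,
      Fintype.card_fin]
  have hden : ∏ k ∈ Finset.univ.erase j, (w j - w k) =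
      (-1) ^ (n + 1) * ∏ k, (w (j.succAbove k) - w j) := by
    simp_rw [prod_erase_eq_prod_succAbove, fun k => (neg_sub (w (j.succAbove k)) (w j)).symm,
      Finset.prod_neg, Finset.card_univ, Fintype.card_fin]
  have hne : ∏ k, (w (j.succAbove k) - w j) ≠ 0 :=
    Finset.prod_ne_zero_iff.mpr fun k _ => sub_ne_zero.mpr (hw.ne (j.succAbove_ne k))
  rw [alternant, alternant, det_vandermonde_cons, det_vandermonde_eq_mul_comp_succAbove w j, hnum,
    hden]
  field_simp
  ring

theorem isPlucker_alternant_iff (τ : B) :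
    IsPlucker (alternant τ : (Fin (n + 1) → K) → K) ↔
      ∀ (z : Fin n → K) (w : Fin (n + 2) → K), Function.Injective z → Function.Injective w →
        Algebra.TensorProduct.productMap (miwa z) (miwa w)
          (residue (laurentTensor (GamStar τ) (Gam τ))) = 0 := by
  constructor
  · intro h z w hz hw
    have hsum := h.pluckerSum_eq_zero z w hw
    rw [pluckerSum_alternant τ z hw, neg_eq_zero] at hsum
    exact (mul_eq_zero.mp hsum).resolve_left
      (mul_ne_zero (Matrix.det_vandermonde_ne_zero_iff.mpr hz)
        (Matrix.det_vandermonde_ne_zero_iff.mpr hw))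
  · intro h
    refine ⟨fun y hy => alternant_of_not_injective τ hy, alternant_comp_perm τ, fun z w hw => ?_⟩
    rw [pluckerSum_alternant τ z hw, neg_eq_zero]
    by_cases hz : Function.Injective z
    · rw [h z w hz hw, mul_zero]
    · rw [not_not.mp (mt Matrix.det_vandermonde_ne_zero_iff.mp hz), zero_mul, zero_mul]

end Residue

/-! ### Wedge products as alternating polynomials -/

theorem constantCoeff_E (s : ℕ) : PowerSeries.constantCoeff (E s) = 1 := by
  simp [E]

theorem coeff_succ_E {s : ℕ} (i : Fin s) :
    PowerSeries.coeff ((i : ℕ) + 1) (E s) = (-1) ^ ((i : ℕ) + 1) * MvPolynomial.X i := by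
  rw [E, map_add, map_sum]
  simp only [PowerSeries.coeff_C_mul, PowerSeries.coeff_X_pow]
  simp [PowerSeries.coeff_one, Fin.val_inj]

theorem incl_coeff_E {s k : ℕ} (hk : k ≤ s) :
    incl s (PowerSeries.coeff k (E s)) = PowerSeries.coeff k (formalExp (-xSeries)) := by
  rcases k with _ | k
  · simp [constantCoeff_E, constantCoeff_formalExp]
  · rw [coeff_succ_E ⟨k, hk⟩]
    simp only [incl, eInf, map_mul, map_pow, map_neg, map_one, MvPolynomial.aeval_X]
    rw [← mul_assoc, ← mul_pow, neg_one_mul, neg_neg, one_pow, one_mul]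

section Points

variable {R : Type*} [CommRing R] [Algebra ℚ R] {s : ℕ}

theorem map_aeval_map_toSymm_E (y : Fin s → R) :
    PowerSeries.map ((MvPolynomial.aeval y : Br s →ₐ[ℚ] R) : Br s →+* R)
        (PowerSeries.map (toSymm s : Br s →+* Br s) (E s)) =
      ∏ j, (1 - PowerSeries.C (y j) * PowerSeries.X) := by
  rw [prod_one_add_eq, map_prod]
  simp

theorem miwa_incl (y : Fin s → R) (p : Br s) :
    miwa y (incl s p) = MvPolynomial.aeval y (toSymm s p) := by
  suffices (miwa y).comp (incl s) = (MvPolynomial.aeval y).comp (toSymm s) from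
    DFunLike.congr_fun this p
  refine MvPolynomial.algHom_ext fun i => ?_
  have hX : (MvPolynomial.X i : Br s) =
      (-1) ^ ((i : ℕ) + 1) * PowerSeries.coeff ((i : ℕ) + 1) (E s) := by
    rw [coeff_succ_E, ← mul_assoc, ← mul_pow, neg_one_mul, neg_neg, one_pow, one_mul]
  have h := (map_miwa_formalExp_neg_xSeries y).trans (map_aeval_map_toSymm_E y).symm
  have hcoeff := congrArg (PowerSeries.coeff ((i : ℕ) + 1)) h
  simp only [PowerSeries.coeff_map, ← incl_coeff_E i.is_lt] at hcoeff
  rw [hX, map_mul, map_mul]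
  simp only [map_pow, map_neg, map_one]
  exact congrArg _ hcoeff

/-- The value at `t` of the polynomial corresponding to `m ∈ M`, where `b n` corresponds to the
power `t ^ n`. -/
noncomputable def evalAt (t : R) : M →ₗ[ℚ] R :=
  Finsupp.linearCombination ℚ fun n => t ^ n

theorem evalAt_b (t : R) (n : ℕ) : evalAt t (b n) = t ^ n := by
  simp [evalAt, b]

theorem exists_evalAt_eq_eval (q : Polynomial ℚ) : ∃ m : M, ∀ t, evalAt t m = q.eval t := by
  induction q using Polynomial.induction_on' with
  | add p q hp hq =>
    obtain ⟨m, hm⟩ := hp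
    obtain ⟨m', hm'⟩ := hq
    exact ⟨m + m', fun t => by rw [map_add, hm, hm', Polynomial.eval_add]⟩
  | monomial n a => exact ⟨Finsupp.single n a, fun t => by simp [evalAt]⟩

/-- The alternating map `(m_i) ↦ det (m_i(y_j))`. -/
noncomputable def evalDet (y : Fin s → R) : M [⋀^Fin s]→ₗ[ℚ] R :=
  { ((Matrix.detRowAlternating (n := Fin s) (R := R)).toMultilinearMap.restrictScalars
      ℚ).compLinearMap fun _ => LinearMap.pi fun j => evalAt (y j) with
    map_eq_zero_of_eq' := fun _ _ _ h hij =>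
      Matrix.det_zero_of_row_eq hij (congrArg (fun m k => evalAt (y k) m) h) }

/-- The linear map `m₁ ∧ ⋯ ∧ m_s ↦ det (m_i(y_j))`. -/
noncomputable def evalWedge (y : Fin s → R) : ⋀[ℚ]^s M →ₗ[ℚ] R :=
  exteriorPower.alternatingMapLinearEquiv (evalDet y)

theorem evalWedge_ιMulti (y : Fin s → R) (m : Fin s → M) :
    evalWedge y (exteriorPower.ιMulti ℚ s m) =
      (Matrix.of fun i j => evalAt (y j) (m i)).det := by
  rw [evalWedge, exteriorPower.alternatingMapLinearEquiv_apply_ιMulti]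
  rfl

theorem evalWedge_wedge (y : Fin s → R) (l : Par s) :
    evalWedge y (wedge l) = MvPolynomial.aeval y (alt (expo l)) := by
  rw [wedge, evalWedge_ιMulti, alt, AlgHom.map_det]
  congr 1
  ext i j
  simp [evalAt_b, expo]

theorem aeval_det_cofac (y : Fin s → R) :
    MvPolynomial.aeval y (Matrix.of (cofac s)).det = (Matrix.vandermonde y).det := by
  have h := toSymm_hDet (r := s) (fun a => (a : ℕ))
  rw [hDet_id, map_one, one_mul] at h
  rw [h, alt, AlgHom.map_det, ← Matrix.det_transpose]
  congr 1
  ext i j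
  simp [Matrix.vandermonde_apply]

theorem evalWedge_phi (y : Fin s → R) (p : Br s) :
    evalWedge y (phi s p) = alternant (incl s p) y := by
  rw [alternant, miwa_incl, ← aeval_det_cofac, ← map_mul, mul_comm]
  suffices (evalWedge y).comp (phi s) = (MvPolynomial.aeval y).toLinearMap.comp
      ((LinearMap.mulRight ℚ (Matrix.of (cofac s)).det).comp (toSymm s).toLinearMap) from
    DFunLike.congr_fun this p
  refine (schurBasis s).ext fun l => ?_
  rw [schurBasis, Module.Basis.mk_apply]
  simp only [LinearMap.comp_apply, phi_schurDet, evalWedge_wedge, LinearMap.mulRight_apply,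
    AlgHom.toLinearMap_apply]
  rw [schurDet_eq_hDet, toSymm_hDet]

end Points

theorem phi_surjective (s : ℕ) : Function.Surjective (phi s) := by
  have hb : Submodule.span ℚ (Set.range b) = ⊤ := by
    rw [← (Finsupp.basisSingleOne (R := ℚ) (ι := ℕ)).span_eq]
    congr 2
  rw [← LinearMap.range_eq_top, eq_top_iff, ← exteriorPower.ιMulti_family_span_of_span ℚ hb,
    Submodule.span_le]
  rintro _ ⟨S, rfl⟩
  obtain ⟨l, hl⟩ := exists_expo (fun i => Set.powersetCard.ofFinEmbEquiv.symm S i)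
    (Set.powersetCard.ofFinEmbEquiv.symm S).strictMono
  refine ⟨schurDet l, ?_⟩
  rw [phi_schurDet, wedge, exteriorPower.ιMulti_family]
  congr 1
  exact funext fun k => congrArg b (congrFun hl k)

theorem eq_zero_of_alternant_incl_eq_zero {s : ℕ} {p : Br s}
    (h : ∀ y : Fin s → ℚ, alternant (incl s p) y = 0) : p = 0 := by
  have hX : alternant (incl s p) (MvPolynomial.X : Fin s → Br s) = 0 := by
    refine MvPolynomial.funext fun y => ?_
    rw [map_zero, ← MvPolynomial.coe_aeval_eq_eval, RingHom.coe_coe, map_alternant]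
    exact h _
  rw [alternant, miwa_incl, MvPolynomial.aeval_X_left_apply] at hX
  exact (map_eq_zero_iff _ (toSymm_injective s)).mp ((mul_eq_zero.mp hX).resolve_left
    (Matrix.det_vandermonde_ne_zero_iff.mpr MvPolynomial.X_injective))

theorem eq_of_evalWedge_eq {s : ℕ} {x x' : ⋀[ℚ]^s M}
    (h : ∀ y : Fin s → ℚ, evalWedge y x = evalWedge y x') : x = x' := by
  obtain ⟨p, hp⟩ := phi_surjective s (x - x')
  have hp₀ : p = 0 := eq_zero_of_alternant_incl_eq_zero fun y => by
    rw [← evalWedge_phi, hp, map_sub, h, sub_self]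
  rw [← sub_eq_zero, ← hp, hp₀, map_zero]

theorem exists_evalAt_eq_alternant_update (τ : B) {s : ℕ} (y : Fin s → ℚ) (i : Fin s) :
    ∃ m : M, ∀ t, evalAt t m = alternant τ (Function.update y i t) := by
  obtain ⟨m, hm⟩ := exists_evalAt_eq_eval
    (alternant τ (Function.update (Polynomial.C ∘ y) i Polynomial.X))
  refine ⟨m, fun t => ?_⟩
  rw [hm, ← Polynomial.coe_aeval_eq_eval, map_alternant, Function.comp_update,
    Polynomial.aeval_X]
  congr 2
  exact funext fun j => Polynomial.aeval_C t (y j)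

theorem smul_mem_cone {n : ℕ} (c : ℚ) {x : ⋀[ℚ]^(n + 1) M} (hx : x ∈ cone (n + 1)) :
    c • x ∈ cone (n + 1) := by
  obtain ⟨m, rfl⟩ := hx
  exact ⟨Function.update m 0 (c • m 0), by
    rw [AlternatingMap.map_update_smul, Function.update_eq_self]⟩

theorem phi_mem_cone_iff_isPlucker {n : ℕ} (p : Br (n + 1)) :
    phi (n + 1) p ∈ cone (n + 1) ↔
      IsPlucker (alternant (incl (n + 1) p) : (Fin (n + 1) → ℚ) → ℚ) := by
  constructor
  · rintro ⟨m, hm⟩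
    have hdet : (alternant (incl (n + 1) p) : (Fin (n + 1) → ℚ) → ℚ) =
        fun y => (Matrix.of fun i j => evalAt (y j) (m i)).det :=
      funext fun y => by rw [← evalWedge_phi, ← hm, evalWedge_ιMulti]
    rw [hdet]
    exact isPlucker_det fun i t => evalAt t (m i)
  · intro h
    by_cases hzero : ∀ y : Fin (n + 1) → ℚ, alternant (incl (n + 1) p) y = 0
    · rw [eq_zero_of_alternant_incl_eq_zero hzero, map_zero]
      exact ⟨0, (exteriorPower.ιMulti ℚ (n + 1)).map_zero⟩
    obtain ⟨y₀, hy₀⟩ := not_forall.mp hzero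
    set c := alternant (incl (n + 1) p) y₀
    choose m hm using exists_evalAt_eq_alternant_update (incl (n + 1) p) y₀
    have hphi : phi (n + 1) p = c • exteriorPower.ιMulti ℚ (n + 1) fun i => c⁻¹ • m i := by
      refine eq_of_evalWedge_eq fun y => ?_
      rw [evalWedge_phi, map_smul, evalWedge_ιMulti, h.eq_mul_det hy₀, smul_eq_mul]
      simp only [map_smul, hm, smul_eq_mul, inv_mul_eq_div, c]
    rw [hphi]
    exact smul_mem_cone c ⟨_, rfl⟩

/-! ### Separation by Miwa variables -/

theorem X_mem_range_incl {n k : ℕ} (hk : k < n) : (MvPolynomial.X k : B) ∈ (incl n).range := by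
  have hx : PowerSeries.coeff (k + 1) (-xSeries) ∈ (incl n).range :=
    coeff_mem_of_coeff_formalExp_mem (by rw [map_neg, constantCoeff_xSeries, neg_zero])
      (incl n).range (fun j hj => AlgHom.mem_range _ |>.mpr ⟨_, incl_coeff_E hj⟩) hk
  simpa [xSeries] using hx

theorem eventually_mem_range_incl (τ : B) : ∀ᶠ n in Filter.atTop, τ ∈ (incl n).range := by
  induction τ using MvPolynomial.induction_on with
  | C a => exact .of_forall fun n => (incl n).range.algebraMap_mem a
  | add p q hp hq => filter_upwards [hp, hq] with n hp hq using add_mem hp hq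
  | mul_X p i hp =>
    filter_upwards [hp, Filter.eventually_gt_atTop i] with n hp hi using
      mul_mem hp (X_mem_range_incl hi)

theorem eq_zero_of_miwa_eq_zero {n : ℕ} {τ : B} (hτ : τ ∈ (incl n).range)
    (h : ∀ y : Fin n → ℚ, Function.Injective y → miwa y τ = 0) : τ = 0 := by
  obtain ⟨p, rfl⟩ := hτ
  have hp : p = 0 := eq_zero_of_alternant_incl_eq_zero fun y => by
    by_cases hy : Function.Injective y
    · rw [alternant]
      exact mul_eq_zero_of_right _ (h y hy)
    · exact alternant_of_not_injective _ hy
  rw [hp]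
  exact map_zero (incl n)

theorem eventually_eq_zero_of_productMap_miwa (T : B ⊗[ℚ] B) : ∀ᶠ n in Filter.atTop,
    (∀ (z : Fin n → ℚ) (w : Fin (n + 2) → ℚ), Function.Injective z → Function.Injective w →
      Algebra.TensorProduct.productMap (miwa z) (miwa w) T = 0) → T = 0 := by
  set β := MvPolynomial.basisMonomials ℕ ℚ
  obtain ⟨c, rfl⟩ := TensorProduct.eq_repr_basis_right β T
  filter_upwards [(Filter.eventually_all_finset c.support).mpr
      fun i _ => eventually_mem_range_incl (c i),
    (Filter.eventually_all_finset c.support).mpr fun i _ =>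
      (Filter.tendsto_add_atTop_nat 2).eventually (eventually_mem_range_incl (β i))]
    with n hc hβ h
  refine Finset.sum_eq_zero fun i hi => ?_
  suffices c i = 0 by rw [this]; exact TensorProduct.zero_tmul _ _
  refine eq_zero_of_miwa_eq_zero (hc i hi) fun z hz => ?_
  have hsum : ∑ j ∈ c.support, miwa z (c j) • β j = 0 := by
    refine eq_zero_of_miwa_eq_zero (n := n + 2)
      (sum_mem fun j hj => (incl (n + 2)).range.smul_mem (hβ j hj) _) fun w hw => ?_
    rw [← h z w hz hw]
    simp only [Finsupp.sum, map_sum, Algebra.TensorProduct.productMap_apply_tmul, map_smul,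
      smul_eq_mul]
  exact linearIndependent_iff'.mp β.linearIndependent _ _ hsum i hi

theorem isPlucker_alternant_of_hirotaKP {τ : B} (h : HirotaKP τ) (n : ℕ) :
    IsPlucker (alternant τ : (Fin (n + 1) → ℚ) → ℚ) :=
  (isPlucker_alternant_iff τ).mpr fun z w _ _ => by
    rw [show residue (laurentTensor (GamStar τ) (Gam τ)) = 0 from h, map_zero]

theorem eventually_hirotaKP_of_isPlucker_alternant (τ : B) : ∀ᶠ n in Filter.atTop,
    IsPlucker (alternant τ : (Fin (n + 1) → ℚ) → ℚ) → HirotaKP τ := by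
  filter_upwards [eventually_eq_zero_of_productMap_miwa
    (residue (laurentTensor (GamStar τ) (Gam τ)))] with n hn h
  exact hn ((isPlucker_alternant_iff τ).mp h)

end KP

theorem mainTheorem5 (τ : KP.B) : KP.CorrespondsToCone τ ↔ KP.HirotaKP τ := by
  constructor
  · rintro ⟨r, hr⟩
    obtain ⟨n, hτ, hn⟩ := ((KP.eventually_hirotaKP_of_isPlucker_alternant τ).and
      (Filter.eventually_ge_atTop r)).exists
    obtain ⟨p, rfl, hp⟩ := hr (n + 1) (hn.trans n.le_succ)
    exact hτ ((KP.phi_mem_cone_iff_isPlucker p).mp hp)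
  · intro h
    obtain ⟨N, hN⟩ := Filter.eventually_atTop.mp (KP.eventually_mem_range_incl τ)
    refine ⟨N + 1, fun s hs => ?_⟩
    obtain ⟨n, rfl⟩ := Nat.exists_eq_succ_of_ne_zero (Nat.ne_zero_of_lt hs)
    obtain ⟨p, hp⟩ := hN (n + 1) (N.le_succ.trans hs)
    refine ⟨p, hp, (KP.phi_mem_cone_iff_isPlucker p).mpr ?_⟩
    rw [show KP.incl (n + 1) p = τ from hp]
    exact KP.isPlucker_alternant_of_hirotaKP h n
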